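/- **Setting.** Let $\Sigma$ be a totally ordered alphabet with least element $\$$ and let $S$ be a null-terminated string of length $\tilde n\ge 1$ over $\Sigma$, that is, $\$$ occurs at the last position of $S$ and nowhere else. Positions are counted from $1$. Let $SA$ be the suffix array of $S$ (the permutation of $[1,\tilde n]$ that lists the suffixes in lexicographic order), let $L$ be its Burrows–Wheeler transform, $L[i]=S[SA[i]-1]$ if $SA[i]>1$ and $L[i]=\$$ otherwise, and let $LF[i]=|\{k: L[k]<L[i]\}|+|\{k\le i: L[k]=L[i]\}|$. **Blocks.** A block $B=d\text{-}[i,j]$ consists of an integer $d\ge 0$ and a non-empty interval $[i,j]\subseteq[1,\tilde n]$ such that $L[LF^x[i]]=L[LF^x[i+1]]=\dots=L[LF^x[j]]$ for all $0\le x\le d$. Its columns are $B_x=[LF^x[i],LF^x[j]]$, $0\le x\le d$, and its height is $h_B=j-i+1$. Two different blocks collide if some column of one intersects some column of the other; the positions in such intersections are called shared. A block is self-colliding if $B_x\cap B_{x'}\ne\emptyset$ for some $x<x'$. A collision of two blocks, named $I$ (inner) and $O$ (outer) so that $h_I\ge h_O$, is compensable if (1) no position in the first column $O_0$ or in the last column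 $O_{d_O}$ of $O$ is shared; (2) there is a row $y,LF[y],\dots,LF^{d_I}[y]$ of $I=d_I\text{-}[i_I,j_I]$, $y\in[i_I,j_I]$, that has no shared position; (3) $|I_x\setminus O_{x'}|\in\{h_I,\,h_I-h_O\}$ for all $0\le x\le d_I$, $0\le x'\le d_O$. A set of blocks has no critical collisions if none of its blocks is self-colliding and any two different colliding blocks in it collide compensably. **Tunneling.** Let $\mathcal B$ be a set of blocks. For all $d\text{-}[i,j]\in\mathcal B$ and $i<k\le j$ set $cntL[LF^x[k]]=0$ for $0\le x<d$ and $cntF[LF^x[k]]=0$ for $0<x\le d$; all other bits of the bitvectors $cntL$, $cntF$ (of size $\tilde n$) are $1$. Then remove all positions $p$ with $cntL[p]=cntF[p]=0$ from $L$, $cntL$ and $cntF$. The resulting triple, again written $(L,cntL,cntF)$, each of size $n$, is the result of tunneling $\mathcal B$. Its generalized LF-mapping is $$LF^*[i]=\mathrm{select}_{cntF}\Big(1,\ \sum_{k=1}^{n}cntL[k]\,\mathbf 1_{L[k]<L[i]}+\sum_{k=1}^{i}cntL[k]\,\mathbf 1_{L[k]=L[i]}\Big),$$ where $\mathrm{select}_{cntF}(1,r)$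 is the position of the $r$-th one in $cntF$. **Algorithm 1.** Input: $(L,cntL,cntF)$ and $\tilde n$, with $cntL[n+1]=cntF[n+1]=1$. Set $S[\tilde n]\gets\$$ and $j\gets 1$, and start with an empty stack. For $i=\tilde n-1,\dots,1$: if $cntF[j+1]=0$, add the top of the stack to $j$ and pop it; set $S[i]\gets L[j]$; if $cntL[j]=0$ or $cntL[j+1]=0$, let $k=\max\{l\in[1,j]: cntL[l]=1\}$ and push $j-k$; set $j\gets LF^*[j]$. **Theorem.** Let $\mathcal B$ be a set of blocks of $S$ without critical collisions, and let $(L,cntL,cntF)$ be the result of tunneling $\mathcal B$. Then: (a) Every step of Algorithm 1 on $(L,cntL,cntF)$ and $\tilde n$ is defined (no empty stack is popped, no position is out of range, and $LF^*$ and the maximum exist where they are used), and the algorithm returns $S$. (b) Algorithm 1 runs in $O(\tilde n)$ time. Precisely, take the implementation of Algorithm 1 on a unit-cost random access machine (with addition, subtraction, comparison and array access) that first computes from its input the table of $LF^*$, by counting characters and tabulating $\mathrm{select}_{cntF}$, and the table of the values $\max\{l\in[1,j]: cntL[l]=1\}$, and then executes the loop with the stack held in an array. For every $K\in\mathbb N$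 there is a constant $c$, depending only on $K$, such that whenever the characters of $S$ are represented, in an order-preserving way, by integers in $[0,\sigma)$ with $\sigma\le K\tilde n$ (for example by their ranks among the characters of $S$, or, when $\Sigma$ is fixed and finite, by their ranks in $\Sigma$), this implementation halts after at most $c\,\tilde n$ steps with output $S$. -/

import Mathlib

/-!
Positions of strings and arrays are counted from `0` throughout: position `p` here is the
position `p + 1` of the usual 1-based convention.
-/

namespace Tunneling

universe u

variable {Γ : Type u} [LinearOrder Γ] {n : ℕ}

/-! ### Strings, suffix array, Burrows-Wheeler transform, LF-mapping -/

/-- `S` is null-terminated: the least character `⊥` of the alphabet (the sentinel `$`) occurs at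
the last position of `S` and nowhere else. In particular `S` is not empty. -/
def NullTerminated [OrderBot Γ] (S : Fin n → Γ) : Prop :=
  0 < n ∧ ∀ p : Fin n, S p = ⊥ ↔ p.val + 1 = n

/-- The suffix of `S` that starts at position `p`. -/
def suffix (S : Fin n → Γ) (p : Fin n) : List Γ :=
  (List.ofFn S).drop p

/-- The suffix array: the permutation that lists the suffixes of `S` in lexicographic order. -/
def suffixArray (S : Fin n → Γ) : Equiv.Perm (Fin n) :=
  Tuple.sort (suffix S)

/-- The Burrows-Wheeler transform of `S`. -/
def bwt [OrderBot Γ] (S : Fin n → Γ) (p : Fin n) : Γ :=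
  if 0 < (suffixArray S p).val then
    S ⟨(suffixArray S p).val - 1, lt_of_le_of_lt (Nat.sub_le _ _) (suffixArray S p).isLt⟩
  else ⊥

theorem lfMapping_lt (L : Fin n → Γ) (p : Fin n) :
    (Finset.univ.filter fun q => L q < L p).card +
      (Finset.univ.filter fun q => q < p ∧ L q = L p).card < n := by
  rw [← Finset.card_union_of_disjoint]
  · have h : (Finset.univ.filter fun q => L q < L p) ∪
        (Finset.univ.filter fun q => q < p ∧ L q = L p) ⊂ Finset.univ := by
      refine Finset.ssubset_univ_iff.2 fun h => ?_
      have hp := Finset.mem_univ p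
      rw [← h] at hp
      simp at hp
    simpa using Finset.card_lt_card h
  · rw [Finset.disjoint_left]
    intro q hq hq'
    simp only [Finset.mem_filter, Finset.mem_univ, true_and] at hq hq'
    exact hq.ne hq'.2

/-- The LF-mapping of `L`: the number of characters of `L` smaller than `L[p]`, plus the number of
occurrences of `L[p]` in `L` before `p` (this is `C[L[p]] + rank(L[p], p)`, counted from `0`). -/
def lfMapping (L : Fin n → Γ) (p : Fin n) : Fin n :=
  ⟨(Finset.univ.filter fun q => L q < L p).card +
    (Finset.univ.filter fun q => q < p ∧ L q = L p).card, lfMapping_lt L p⟩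

/-! ### Blocks and their collisions -/

/-- The data of a `d`-`[i, j]`-block. -/
@[ext]
structure Block (n : ℕ) where
  d : ℕ
  i : Fin n
  j : Fin n

/-- `B` is a block of the Burrows-Wheeler transform `L`: `[i, j]` is a non-empty interval, and for
all `x ≤ d` the characters at the positions `LF^x[i], LF^x[i+1], …, LF^x[j]` of `L` agree. -/
def IsBlock (L : Fin n → Γ) (B : Block n) : Prop :=
  B.i ≤ B.j ∧ ∀ x ≤ B.d, ∀ p ∈ Set.Icc B.i B.j,
    L ((lfMapping L)^[x] p) = L ((lfMapping L)^[x] B.i)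

/-- The height `j - i + 1` of a block. -/
def Block.height (B : Block n) : ℕ := B.j.val - B.i.val + 1

/-- The `x`-th column `[LF^x[i], LF^x[j]]` of a block. -/
def column (L : Fin n → Γ) (B : Block n) (x : ℕ) : Set (Fin n) :=
  Set.Icc ((lfMapping L)^[x] B.i) ((lfMapping L)^[x] B.j)

/-- `p` is a position shared by `B` and `B'`: it lies in a column of either block. -/
def SharedPosition (L : Fin n → Γ) (B B' : Block n) (p : Fin n) : Prop :=
  (∃ x ≤ B.d, p ∈ column L B x) ∧ (∃ x' ≤ B'.d, p ∈ column L B' x')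

/-- Two (different) blocks collide if they share a position. -/
def Collide (L : Fin n → Γ) (B B' : Block n) : Prop :=
  ∃ x ≤ B.d, ∃ x' ≤ B'.d, (column L B x ∩ column L B' x').Nonempty

/-- A block is self-colliding if two different columns of it intersect. -/
def SelfColliding (L : Fin n → Γ) (B : Block n) : Prop :=
  ∃ x ≤ B.d, ∃ x' ≤ B.d, x < x' ∧ (column L B x ∩ column L B x').Nonempty

/-- The conditions for a compensable collision with inner block `I` and outer block `O`:
the leftmost and rightmost columns of `O` contain no shared position; some row of `I` contains no
shared position; and any column of `I` is either disjoint from a given column of `O`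
or contains it. -/
structure CompensableAs (L : Fin n → Γ) (I O : Block n) : Prop where
  height_le : O.height ≤ I.height
  start_unshared : ∀ p ∈ column L O 0, ¬ SharedPosition L I O p
  end_unshared : ∀ p ∈ column L O O.d, ¬ SharedPosition L I O p
  row_unshared : ∃ y ∈ Set.Icc I.i I.j, ∀ x ≤ I.d,
    ¬ SharedPosition L I O ((lfMapping L)^[x] y)
  proper_intersection : ∀ x ≤ I.d, ∀ x' ≤ O.d,
    (column L I x \ column L O x').ncard = I.height ∨
      (column L I x \ column L O x').ncard = I.height - O.height

/-- The collision of `B` and `B'` is compensable; the higher one of them is the inner block. -/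
def Compensable (L : Fin n → Γ) (B B' : Block n) : Prop :=
  CompensableAs L B B' ∨ CompensableAs L B' B

/-- A set of blocks without critical collisions. -/
def NoCriticalCollisions (L : Fin n → Γ) (𝓑 : Set (Block n)) : Prop :=
  (∀ B ∈ 𝓑, ¬ SelfColliding L B) ∧
    ∀ B ∈ 𝓑, ∀ B' ∈ 𝓑, B ≠ B' → Collide L B B' → Compensable L B B'

/-! ### Tunneling -/

/-- The positions that are crossed out in `L` when the blocks of `𝓑` are tunneled. -/
def crossedL (L : Fin n → Γ) (𝓑 : Set (Block n)) : Set (Fin n) :=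
  {p | ∃ B ∈ 𝓑, ∃ x < B.d, ∃ k ∈ Set.Ioc B.i B.j, p = (lfMapping L)^[x] k}

/-- The positions that are crossed out in `F` when the blocks of `𝓑` are tunneled. -/
def crossedF (L : Fin n → Γ) (𝓑 : Set (Block n)) : Set (Fin n) :=
  {p | ∃ B ∈ 𝓑, ∃ x, 0 < x ∧ x ≤ B.d ∧ ∃ k ∈ Set.Ioc B.i B.j, p = (lfMapping L)^[x] k}

/-- A triple `(L, cntL, cntF)` of a string and two bitvectors of the same size. A bit is `false`
(that is, `0`) where the position is crossed out. -/
structure TunneledBWT (Γ : Type u) where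
  size : ℕ
  L : Fin size → Γ
  cntL : Fin size → Bool
  cntF : Fin size → Bool

open Classical in
/-- The positions that remain: those that are not crossed out both in `L` and in `F`. -/
noncomputable def remaining (L : Fin n → Γ) (𝓑 : Set (Block n)) : Finset (Fin n) :=
  Finset.univ.filter fun p => ¬ (p ∈ crossedL L 𝓑 ∧ p ∈ crossedF L 𝓑)

open Classical in
/-- The result of tunneling the blocks of `𝓑`: cross out positions in `L` and in `F`, then remove
the positions that are crossed out in both, keeping the order of the others. -/
noncomputable def tunnel (L : Fin n → Γ) (𝓑 : Set (Block n)) : TunneledBWT Γ where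
  size := (remaining L 𝓑).card
  L := fun p => L ((remaining L 𝓑).orderEmbOfFin rfl p)
  cntL := fun p => decide ((remaining L 𝓑).orderEmbOfFin rfl p ∉ crossedL L 𝓑)
  cntF := fun p => decide ((remaining L 𝓑).orderEmbOfFin rfl p ∉ crossedF L 𝓑)

/-! ### The reconstruction algorithm, stated on the level of its pseudo-code -/

/-- A bitvector, extended by ones beyond its end (only the first of these is used). -/
def bitAt (b : Fin n → Bool) (p : ℕ) : Bool :=
  if h : p < n then b ⟨p, h⟩ else true

/-- `select_b(1, r)`: the position of the `r`-th one (`r = 1, 2, …`) of `b`, if there is one. -/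
def selectOne (b : Fin n → Bool) (r : ℕ) : Option (Fin n) :=
  (List.finRange n).find? fun p =>
    b p && decide ((Finset.univ.filter fun q => q ≤ p ∧ b q = true).card = r)

/-- The generalized LF-mapping of `(L, cntL, cntF)`. -/
def generalizedLF (T : TunneledBWT Γ) (p : Fin T.size) : Option (Fin T.size) :=
  selectOne T.cntF
    ((Finset.univ.filter fun q => T.cntL q = true ∧ T.L q < T.L p).card +
      (Finset.univ.filter fun q => q ≤ p ∧ T.cntL q = true ∧ T.L q = T.L p).card)

/-- The largest `l ≤ j` with `cntL[l] = 1`, if there is one. -/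
def uppermost (T : TunneledBWT Γ) (j : Fin T.size) : Option (Fin T.size) :=
  (List.finRange T.size).reverse.find? fun l => decide (l ≤ j) && T.cntL l

/-- End of a tunnel: if `cntF[j+1] = 0`, add the top of the stack to `j` and pop it.
It fails if the stack is empty or if the new position is out of range. -/
def leaveTunnel (T : TunneledBWT Γ) (j : Fin T.size) (stack : List ℕ) :
    Option (Fin T.size × List ℕ) :=
  if bitAt T.cntF (j + 1) = false then
    match stack with
    | [] => none
    | o :: stack' => if h : j.val + o < T.size then some (⟨j.val + o, h⟩, stack') else none
  else some (j, stack)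

/-- Start of a tunnel: if `cntL[j] = 0` or `cntL[j+1] = 0`, push the offset of `j` to the
uppermost row. -/
def enterTunnel (T : TunneledBWT Γ) (j : Fin T.size) (stack : List ℕ) : Option (List ℕ) :=
  if T.cntL j = false ∨ bitAt T.cntL (j + 1) = false then
    (uppermost T j).map fun k => (j.val - k.val) :: stack
  else some stack

/-- The loop of the reconstruction algorithm, with the number of remaining iterations, the
position `j`, the stack, and the part of the text that is already reconstructed. Each iteration
puts one more character in front of that part. -/
def reconstructLoop (T : TunneledBWT Γ) :
    ℕ → Fin T.size → List ℕ → List Γ → Option (List Γ)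
  | 0, _, _, acc => some acc
  | m + 1, j, stack, acc =>
    (leaveTunnel T j stack).bind fun (j', stack') =>
      (enterTunnel T j' stack').bind fun stack'' =>
        (generalizedLF T j').bind fun j'' =>
          reconstructLoop T m j'' stack'' (T.L j' :: acc)

/-- The reconstruction algorithm for a text of length `len`: the last character is `⊥` (that is,
`$`), the walk starts at the first position with the empty stack, and it takes `len - 1` steps.
The result is `none` if some step of the algorithm is not defined. -/
def reconstruct [OrderBot Γ] (T : TunneledBWT Γ) (len : ℕ) : Option (List Γ) :=
  if h : 0 < T.size then reconstructLoop T (len - 1) ⟨0, h⟩ [] [⊥] else none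

/-! ### A random access machine with unit cost -/

/-- The registers of the machine. -/
inductive Reg
  | size | textLen | alphabetSize | dollar | i | j | k | c | sum | sp
  deriving DecidableEq

/-- The arrays of the machine. -/
inductive Arr
  | L | cntL | cntF | C | sel | top | LF | stack | S
  deriving DecidableEq

/-- A state of the machine: natural numbers in the registers and in the cells of the arrays. -/
structure State where
  reg : Reg → ℕ
  arr : Arr → ℕ → ℕ

/-- Arithmetic expressions; the only operations are addition and truncated subtraction. -/
inductive Expr
  | lit (v : ℕ)
  | reg (r : Reg)
  | get (a : Arr) (e : Expr)
  | add (e₁ e₂ : Expr)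
  | sub (e₁ e₂ : Expr)

def Expr.eval (s : State) : Expr → ℕ
  | lit v => v
  | reg r => s.reg r
  | get a e => s.arr a (e.eval s)
  | add e₁ e₂ => e₁.eval s + e₂.eval s
  | sub e₁ e₂ => e₁.eval s - e₂.eval s

/-- The number of elementary operations in the evaluation of an expression. -/
def Expr.cost : Expr → ℕ
  | lit _ => 1
  | reg _ => 1
  | get _ e => e.cost + 1
  | add e₁ e₂ => e₁.cost + e₂.cost + 1
  | sub e₁ e₂ => e₁.cost + e₂.cost + 1

/-- Tests. -/
inductive Test
  | eq (e₁ e₂ : Expr)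
  | lt (e₁ e₂ : Expr)
  | or (b₁ b₂ : Test)

def Test.eval (s : State) : Test → Bool
  | eq e₁ e₂ => decide (e₁.eval s = e₂.eval s)
  | lt e₁ e₂ => decide (e₁.eval s < e₂.eval s)
  | or b₁ b₂ => b₁.eval s || b₂.eval s

/-- The number of elementary operations in the evaluation of a test. -/
def Test.cost : Test → ℕ
  | eq e₁ e₂ => e₁.cost + e₂.cost + 1
  | lt e₁ e₂ => e₁.cost + e₂.cost + 1
  | or b₁ b₂ => b₁.cost + b₂.cost + 1

/-- Programs. -/
inductive Prog
  | skip
  | assign (r : Reg) (e : Expr)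
  | store (a : Arr) (idx e : Expr)
  | seq (P Q : Prog)
  | ite (b : Test) (P Q : Prog)
  | while (b : Test) (P : Prog)

def State.setReg (s : State) (r : Reg) (v : ℕ) : State :=
  { s with reg := Function.update s.reg r v }

def State.setArr (s : State) (a : Arr) (idx v : ℕ) : State :=
  { s with arr := Function.update s.arr a (Function.update (s.arr a) idx v) }

/-- `Exec P s t s'`: started in the state `s`, the program `P` halts after exactly `t` steps in
the state `s'`. -/
inductive Exec : Prog → State → ℕ → State → Prop
  | skip (s : State) : Exec .skip s 1 s
  | assign (r : Reg) (e : Expr) (s : State) :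
      Exec (.assign r e) s (e.cost + 1) (s.setReg r (e.eval s))
  | store (a : Arr) (idx e : Expr) (s : State) :
      Exec (.store a idx e) s (idx.cost + e.cost + 1) (s.setArr a (idx.eval s) (e.eval s))
  | seq {P Q : Prog} {s s' s'' : State} {t t' : ℕ} :
      Exec P s t s' → Exec Q s' t' s'' → Exec (.seq P Q) s (t + t') s''
  | ite_true {b : Test} {P Q : Prog} {s s' : State} {t : ℕ} :
      b.eval s = true → Exec P s t s' → Exec (.ite b P Q) s (b.cost + t) s'
  | ite_false {b : Test} {P Q : Prog} {s s' : State} {t : ℕ} :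
      b.eval s = false → Exec Q s t s' → Exec (.ite b P Q) s (b.cost + t) s'
  | while_true {b : Test} {P : Prog} {s s' s'' : State} {t t' : ℕ} :
      b.eval s = true → Exec P s t s' → Exec (.while b P) s' t' s'' →
        Exec (.while b P) s (b.cost + t + t') s''
  | while_false {b : Test} {P : Prog} {s : State} :
      b.eval s = false → Exec (.while b P) s b.cost s

/-! ### The reconstruction algorithm as a machine program -/

local infixr:60 " ;; " => Prog.seq

/-- `for r ← 0 to bound - 1 do P`. -/
def Prog.forUpTo (r bound : Reg) (P : Prog) : Prog :=
  .assign r (.lit 0) ;;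
  .while (.lt (.reg r) (.reg bound)) (P ;; .assign r (.add (.reg r) (.lit 1)))

/-- `C[c] ←` number of occurrences of `c` in `L` that are not crossed out. -/
def countChars : Prog :=
  .forUpTo .i .size
    (.store .C (.get .L (.reg .i))
      (.add (.get .C (.get .L (.reg .i))) (.get .cntL (.reg .i))))

/-- `C[c] ←` number of characters smaller than `c` in `L` that are not crossed out. -/
def prefixSums : Prog :=
  .assign .sum (.lit 0) ;;
  .forUpTo .c .alphabetSize
    (.assign .k (.get .C (.reg .c)) ;;
     .store .C (.reg .c) (.reg .sum) ;;
     .assign .sum (.add (.reg .sum) (.reg .k)))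

/-- `sel[r] ←` position of the one number `r + 1` in `cntF`. -/
def selectTable : Prog :=
  .assign .k (.lit 0) ;;
  .forUpTo .i .size
    (.ite (.eq (.get .cntF (.reg .i)) (.lit 1))
      (.store .sel (.reg .k) (.reg .i) ;; .assign .k (.add (.reg .k) (.lit 1)))
      .skip)

/-- `LF[i] ←` generalized LF-mapping at `i`. -/
def lfTable : Prog :=
  .forUpTo .i .size
    (.store .C (.get .L (.reg .i))
      (.add (.get .C (.get .L (.reg .i))) (.get .cntL (.reg .i))) ;;
     .store .LF (.reg .i)
      (.get .sel (.sub (.get .C (.get .L (.reg .i))) (.lit 1))))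

/-- `top[i] ←` largest `l ≤ i` with `cntL[l] = 1`. -/
def topTable : Prog :=
  .assign .k (.lit 0) ;;
  .forUpTo .i .size
    (.ite (.eq (.get .cntL (.reg .i)) (.lit 1)) (.assign .k (.reg .i)) .skip ;;
     .store .top (.reg .i) (.reg .k))

/-- The walk; the register `sp` holds the number of elements of the stack. -/
def walk : Prog :=
  .store .S (.sub (.reg .textLen) (.lit 1)) (.reg .dollar) ;;
  .assign .sp (.lit 0) ;;
  .assign .j (.lit 0) ;;
  .assign .i (.sub (.reg .textLen) (.lit 1)) ;;
  .while (.lt (.lit 0) (.reg .i))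
    (.assign .i (.sub (.reg .i) (.lit 1)) ;;
     .ite (.eq (.get .cntF (.add (.reg .j) (.lit 1))) (.lit 0))
      (.assign .j (.add (.reg .j) (.get .stack (.sub (.reg .sp) (.lit 1)))) ;;
       .assign .sp (.sub (.reg .sp) (.lit 1)))
      .skip ;;
     .store .S (.reg .i) (.get .L (.reg .j)) ;;
     .ite (.or (.eq (.get .cntL (.reg .j)) (.lit 0))
          (.eq (.get .cntL (.add (.reg .j) (.lit 1))) (.lit 0)))
      (.assign .k (.get .top (.reg .j)) ;;
       .store .stack (.reg .sp) (.sub (.reg .j) (.reg .k)) ;;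
       .assign .sp (.add (.reg .sp) (.lit 1)))
      .skip ;;
     .assign .j (.get .LF (.reg .j)))

/-- The reconstruction algorithm: precompute the generalized LF-mapping and the uppermost rows,
then walk. -/
def reconstructProgram : Prog :=
  countChars ;; prefixSums ;; selectTable ;; lfTable ;; topTable ;; walk

/-- The initial state for the input `(L, cntL, cntF)`, a text length `len`, and characters
represented by numbers below `σ` through `code`. The bitvectors have one more entry, which is `1`.
All other registers and cells are `0`. -/
def initState [OrderBot Γ] (T : TunneledBWT Γ) (len : ℕ) (code : Γ → ℕ) (σ : ℕ) : State where
  reg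
    | .size => T.size
    | .textLen => len
    | .alphabetSize => σ
    | .dollar => code ⊥
    | _ => 0
  arr
    | .L => fun p => if h : p < T.size then code (T.L ⟨p, h⟩) else 0
    | .cntL => fun p => if p ≤ T.size then (bitAt T.cntL p).toNat else 0
    | .cntF => fun p => if p ≤ T.size then (bitAt T.cntF p).toNat else 0
    | _ => fun _ => 0

end Tunneling

namespace Tunneling

universe u

section

variable {Γ : Type u} [LinearOrder Γ] {n : ℕ}

/-! ### The LF-mapping of a string -/

/-! The LF-mapping of a Burrows-Wheeler transform sends a suffix to its cyclic predecessor, so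
iterating it from position 0 reads the string backwards (`bwt_iterate`). The algorithm imitates this
walk in the tunneled transform. The proof determines where the imitation stands while the genuine
walk is at `p`.

Without critical collisions the removed positions are exactly those of `middle` (`mem_middle_iff`).
Before a tunnel is left, the algorithm stands at the last position up to `p` that is not crossed out
in F; afterwards it stands at the last one that is not removed. The character there is that of `p`,
because a run of crossed-out positions continues the character above it. The generalized LF-mapping
then leads to the image of the last position up to `p` that is not crossed out in L
(`generalizedLF_eq_some`), and this is the last position up to `LF p` that is not crossed out in F
(`lastOutside_crossedF_lfMapping`), so the description persists.

Leaving a tunnel means adding the distance between the two positions, counted by `tunnelOffset`.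
This number is the same at the start and at the end of a block, since its first and last columns
lose the same rows (`iterate_mem_middle_iff`, `tunnelOffset_crossedF_eq`). Whether a tunnel starts
or ends at `p` can be read off the bits (`IsCrossedAt.nextIn_iff`). Compensability enters through
`eq_or_compensableAs_of_mem_end`: an end column of a block can be met only by outer blocks, away
from their own ends. Hence also the times spent in tunnels are strictly nested (`exitTime_nested`),
and the offset needed on leaving is on top of the stack, whose contents are given explicitly by
`stackAt`.

For the running time, every table is filled by one loop (`exec_forUpTo`), and the machine follows a
run of the abstract algorithm that is already known to succeed, so no undefined value is ever used
(`exec_walkLoop`). -/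

theorem lfMapping_val (L : Fin n → Γ) (p : Fin n) :
    (lfMapping L p).val =
      (Finset.univ.filter fun q => L q < L p ∨ (L q = L p ∧ q < p)).card := by
  rw [Finset.filter_or, Finset.card_union_of_disjoint]
  · simp only [lfMapping, and_comm]
  · rw [Finset.disjoint_left]
    intro q hq hq'
    simp only [Finset.mem_filter, Finset.mem_univ, true_and] at hq hq'
    exact hq.ne hq'.1

theorem lfMapping_lt_of (L : Fin n → Γ) {p q : Fin n}
    (h : L p < L q ∨ (L p = L q ∧ p < q)) : lfMapping L p < lfMapping L q := by
  rw [Fin.lt_def, lfMapping_val, lfMapping_val]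
  apply Finset.card_lt_card
  rw [Finset.ssubset_iff_of_subset]
  · exact ⟨p, by simpa using h, by simp⟩
  · intro r hr
    simp only [Finset.mem_filter, Finset.mem_univ, true_and] at hr ⊢
    rcases hr with hr | ⟨hr, hr'⟩ <;> rcases h with h | ⟨h, h'⟩
    · exact Or.inl (hr.trans h)
    · exact Or.inl (h ▸ hr)
    · exact Or.inl (hr ▸ h)
    · exact Or.inr ⟨hr.trans h, hr'.trans h'⟩

theorem lfMapping_lt_iff (L : Fin n → Γ) {p q : Fin n} :
    lfMapping L p < lfMapping L q ↔ L p < L q ∨ (L p = L q ∧ p < q) := by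
  refine ⟨fun h => ?_, lfMapping_lt_of L⟩
  by_contra hc
  rcases lt_trichotomy (L p) (L q) with h1 | h1 | h1
  · exact hc (Or.inl h1)
  · rcases lt_trichotomy p q with h2 | h2 | h2
    · exact hc (Or.inr ⟨h1, h2⟩)
    · exact h.ne (by rw [h2])
    · exact lt_asymm h (lfMapping_lt_of L (Or.inr ⟨h1.symm, h2⟩))
  · exact lt_asymm h (lfMapping_lt_of L (Or.inl h1))

theorem lfMapping_injective (L : Fin n → Γ) : Function.Injective (lfMapping L) := by
  intro p q h
  have h1 : ¬ lfMapping L p < lfMapping L q := by rw [h]; exact lt_irrefl _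
  have h2 : ¬ lfMapping L q < lfMapping L p := by rw [h]; exact lt_irrefl _
  rw [lfMapping_lt_iff] at h1 h2
  push Not at h1 h2
  have h3 := le_antisymm h2.1 h1.1
  exact le_antisymm (h2.2 h3.symm) (h1.2 h3)

theorem lfMapping_surjective (L : Fin n → Γ) : Function.Surjective (lfMapping L) :=
  Finite.surjective_of_injective (lfMapping_injective L)

/-- LF is the rank in the order by character and then by position. A gap between the two images
would, by surjectivity, be the image of something strictly between two neighbours of that order. -/
theorem lfMapping_succ (L : Fin n → Γ) {p q : Fin n} (hpq : q.val = p.val + 1)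
    (hL : L q = L p) : (lfMapping L q).val = (lfMapping L p).val + 1 := by
  have h1 : lfMapping L p < lfMapping L q :=
    lfMapping_lt_of L (Or.inr ⟨hL.symm, by rw [Fin.lt_def]; omega⟩)
  by_contra hne
  have h2 : (lfMapping L p).val + 1 < (lfMapping L q).val := by rw [Fin.lt_def] at h1; omega
  obtain ⟨w, hw⟩ := lfMapping_surjective L ⟨(lfMapping L p).val + 1, h2.trans (Fin.isLt _)⟩
  have h3 : lfMapping L p < lfMapping L w := by rw [hw, Fin.lt_def]; simp
  have h4 : lfMapping L w < lfMapping L q := by rw [hw, Fin.lt_def]; exact h2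
  rw [lfMapping_lt_iff] at h3 h4
  rcases h3 with h3 | ⟨h3, h3'⟩ <;> rcases h4 with h4 | ⟨h4, h4'⟩
  · exact lt_asymm h3 (hL ▸ h4)
  · rw [h4, hL] at h3; exact lt_irrefl _ h3
  · rw [← h3, hL] at h4; exact lt_irrefl _ h4
  · rw [Fin.lt_def] at h3' h4'; omega

theorem lfMapping_interval (L : Fin n → Γ) {p q : Fin n} (hpq : p ≤ q)
    (hL : ∀ r ∈ Set.Icc p q, L r = L p) :
    (lfMapping L q).val = (lfMapping L p).val + (q.val - p.val) := by
  obtain ⟨m, hm⟩ : ∃ m, q.val = p.val + m := ⟨q.val - p.val, by rw [Fin.le_def] at hpq; omega⟩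
  induction m generalizing q with
  | zero =>
    have : q = p := Fin.ext (by omega)
    subst this
    simp
  | succ m ih =>
    let q' : Fin n := ⟨p.val + m, by omega⟩
    have hq' : p ≤ q' := by simp [Fin.le_def, q']
    have hq'' : q' ≤ q := by simp [Fin.le_def, q', hm]
    have h1 := ih hq' (fun r hr => hL r ⟨hr.1, hr.2.trans hq''⟩) rfl
    have h2 : (lfMapping L q).val = (lfMapping L q').val + 1 := by
      apply lfMapping_succ
      · simp [q', hm]; omega
      · rw [hL q ⟨hpq, le_rfl⟩, hL q' ⟨hq', hq''⟩]
    simp only [q'] at h1 h2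
    omega

/-! ### The LF-mapping of a Burrows-Wheeler transform -/

omit [LinearOrder Γ] in
theorem suffix_eq_cons (S : Fin n → Γ) (p : Fin n) :
    suffix S p = S p :: (List.ofFn S).drop (p + 1) := by
  rw [suffix, List.drop_eq_getElem_cons (by simp)]
  simp

omit [LinearOrder Γ] in
theorem suffix_injective (S : Fin n → Γ) : Function.Injective (suffix S) := by
  intro p q h
  have := congrArg List.length h
  simp only [suffix, List.length_drop, List.length_ofFn] at this
  exact Fin.ext (by omega)

theorem suffix_suffixArray_lt (S : Fin n → Γ) {p q : Fin n} :
    suffix S (suffixArray S p) < suffix S (suffixArray S q) ↔ p < q := by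
  have h : StrictMono (suffix S ∘ suffixArray S) :=
    (Tuple.monotone_sort (suffix S)).strictMono_of_injective
      ((suffix_injective S).comp (suffixArray S).injective)
  exact h.lt_iff_lt

/-- The cyclic predecessor of a text position. -/
def cyclicPred (p : Fin n) : Fin n :=
  if 0 < p.val then ⟨p.val - 1, by omega⟩ else ⟨n - 1, by have := p.isLt; omega⟩

theorem cyclicPred_injective : Function.Injective (cyclicPred (n := n)) := by
  intro p q h
  unfold cyclicPred at h
  apply Fin.ext
  split_ifs at h with h1 h2 h2 <;> simp only [Fin.mk.injEq] at h <;> omega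

section OrderBot

variable [OrderBot Γ]

theorem NullTerminated.pos {S : Fin n → Γ} (hS : NullTerminated S) : 0 < n :=
  hS.1

theorem bwt_eq_bot_iff {S : Fin n → Γ} (hS : NullTerminated S) (p : Fin n) :
    bwt S p = ⊥ ↔ (suffixArray S p).val = 0 := by
  unfold bwt
  split_ifs with h
  · rw [hS.2]
    simp only
    have := (suffixArray S p).isLt
    omega
  · simp; omega

theorem bwt_mem_range {S : Fin n → Γ} (hS : NullTerminated S) (p : Fin n) :
    bwt S p ∈ Set.range S := by
  unfold bwt
  split_ifs with h
  · exact ⟨_, rfl⟩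
  · exact ⟨⟨n - 1, by have := hS.pos; omega⟩, (hS.2 _).2 (by have := hS.pos; simp; omega)⟩

theorem suffix_cyclicPred {S : Fin n → Γ} (p : Fin n)
    (h : 0 < (suffixArray S p).val) :
    suffix S (cyclicPred (suffixArray S p)) = bwt S p :: suffix S (suffixArray S p) := by
  rw [suffix_eq_cons]
  simp only [cyclicPred, bwt, h, if_true, suffix]
  congr 2
  omega

theorem suffix_cyclicPred_zero {S : Fin n → Γ} (hS : NullTerminated S) (p : Fin n)
    (h : (suffixArray S p).val = 0) :
    suffix S (cyclicPred (suffixArray S p)) = [⊥] := by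
  have hn := hS.pos
  rw [suffix_eq_cons]
  have h1 : cyclicPred (suffixArray S p) = ⟨n - 1, by omega⟩ := by simp [cyclicPred, h]
  rw [h1, (hS.2 _).2 (by simp; omega)]
  congr 1
  apply List.drop_eq_nil_of_le
  simp; omega

/-- The suffix at the predecessor is the transform's character followed by the old suffix, so heads
are compared first and then tails, which are ordered as their ranks. The suffix starting at text
position 0 wraps around to `[⊥]` instead; this does no harm because `⊥` occurs only once in the
transform. -/
theorem suffix_cyclicPred_lt_iff {S : Fin n → Γ} (hS : NullTerminated S) (p q : Fin n) :
    suffix S (cyclicPred (suffixArray S p)) < suffix S (cyclicPred (suffixArray S q)) ↔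
      bwt S p < bwt S q ∨ (bwt S p = bwt S q ∧ p < q) := by
  by_cases hpq : p = q
  · subst hpq; simp
  rcases Nat.eq_zero_or_pos (suffixArray S p).val with hp | hp
  · have hq : 0 < (suffixArray S q).val := by
      by_contra hq
      exact hpq ((suffixArray S).injective (Fin.ext (by omega)))
    have hq' : bwt S q ≠ ⊥ := fun h => by rw [bwt_eq_bot_iff hS] at h; omega
    rw [suffix_cyclicPred_zero hS p hp, suffix_cyclicPred q hq, (bwt_eq_bot_iff hS p).2 hp,
      List.cons_lt_cons_iff]
    simp [bot_lt_iff_ne_bot.2 hq']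
  · rcases Nat.eq_zero_or_pos (suffixArray S q).val with hq | hq
    · have hp' : bwt S p ≠ ⊥ := fun h => by rw [bwt_eq_bot_iff hS] at h; omega
      rw [suffix_cyclicPred_zero hS q hq, suffix_cyclicPred p hp, (bwt_eq_bot_iff hS q).2 hq,
        List.cons_lt_cons_iff]
      simp [hp']
    · rw [suffix_cyclicPred p hp, suffix_cyclicPred q hq, List.cons_lt_cons_iff,
        suffix_suffixArray_lt]

theorem suffixArray_lfMapping {S : Fin n → Γ} (hS : NullTerminated S) (p : Fin n) :
    suffixArray S (lfMapping (bwt S) p) = cyclicPred (suffixArray S p) := by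
  have hbij : Function.Bijective
      (fun q => (suffixArray S).symm (cyclicPred (suffixArray S q))) :=
    Finite.injective_iff_bijective.1 ((suffixArray S).symm.injective.comp
      (cyclicPred_injective.comp (suffixArray S).injective))
  rw [← Equiv.eq_symm_apply]
  apply Fin.ext
  -- A position equals the number of positions below it, so it suffices to biject the positions
  -- counted by LF with those below the claimed value.
  rw [lfMapping_val, ← Fin.card_Iio]
  refine Finset.card_bij (fun q _ => (suffixArray S).symm (cyclicPred (suffixArray S q))) ?_ ?_ ?_
  · intro q hq
    rw [Finset.mem_Iio, ← suffix_suffixArray_lt S]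
    simpa [suffix_cyclicPred_lt_iff hS] using hq
  · intro q _ q' _ h
    exact hbij.1 h
  · intro q hq
    obtain ⟨r, rfl⟩ := hbij.2 q
    refine ⟨r, ?_, rfl⟩
    rw [Finset.mem_Iio, ← suffix_suffixArray_lt S] at hq
    simpa [suffix_cyclicPred_lt_iff hS] using hq

theorem lfMapping_eq_zero {S : Fin n → Γ} (hS : NullTerminated S) {p : Fin n}
    (hp : bwt S p = ⊥) : (lfMapping (bwt S) p).val = 0 := by
  rw [lfMapping_val, Finset.card_eq_zero, Finset.filter_eq_empty_iff]
  rintro q - (h | ⟨h, h'⟩)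
  · rw [hp] at h; exact not_lt_bot h
  · rw [hp, bwt_eq_bot_iff hS] at h
    rw [bwt_eq_bot_iff hS] at hp
    exact h'.ne ((suffixArray S).injective (Fin.ext (by omega)))

theorem lfMapping_eq_zero_iff {S : Fin n → Γ} (hS : NullTerminated S) {p : Fin n} :
    (lfMapping (bwt S) p).val = 0 ↔ bwt S p = ⊥ := by
  refine ⟨fun h => ?_, lfMapping_eq_zero hS⟩
  have h0 : bwt S ((suffixArray S).symm ⟨0, hS.pos⟩) = ⊥ := by
    rw [bwt_eq_bot_iff hS]; simp
  have := lfMapping_injective (bwt S) (Fin.ext (h.trans (lfMapping_eq_zero hS h0).symm))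
  rwa [this]

theorem suffixArray_zero {S : Fin n → Γ} (hS : NullTerminated S) :
    (suffixArray S ⟨0, hS.pos⟩).val = n - 1 := by
  have h0 : bwt S ((suffixArray S).symm ⟨0, hS.pos⟩) = ⊥ := by
    rw [bwt_eq_bot_iff hS]; simp
  have h1 : lfMapping (bwt S) ((suffixArray S).symm ⟨0, hS.pos⟩) = ⟨0, hS.pos⟩ :=
    Fin.ext (lfMapping_eq_zero hS h0)
  rw [← h1, suffixArray_lfMapping hS]
  simp [cyclicPred]

theorem suffixArray_iterate {S : Fin n → Γ} (hS : NullTerminated S) (t : ℕ) (ht : t < n) :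
    (suffixArray S ((lfMapping (bwt S))^[t] ⟨0, hS.pos⟩)).val = n - 1 - t := by
  induction t with
  | zero => simpa using suffixArray_zero hS
  | succ t ih =>
    have h1 := ih (by omega)
    rw [Function.iterate_succ_apply', suffixArray_lfMapping hS, cyclicPred, if_pos (by omega)]
    simp only
    omega

/-- Walking through the Burrows-Wheeler transform with the LF-mapping reads the text backwards. -/
theorem bwt_iterate {S : Fin n → Γ} (hS : NullTerminated S) (t : ℕ) (ht : t + 1 < n) :
    bwt S ((lfMapping (bwt S))^[t] ⟨0, hS.pos⟩) = S ⟨n - 2 - t, by omega⟩ := by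
  have h := suffixArray_iterate hS t (by omega)
  rw [bwt, if_pos (by omega)]
  congr 1
  apply Fin.ext
  simp only
  omega

theorem bwt_injective_at_bot {S : Fin n → Γ} (hS : NullTerminated S) {p q : Fin n}
    (hp : bwt S p = ⊥) (hq : bwt S q = ⊥) : p = q := by
  rw [bwt_eq_bot_iff hS] at hp hq
  exact (suffixArray S).injective (Fin.ext (hp.trans hq.symm))

end OrderBot

/-! ### Columns of blocks -/

section Columns

variable {L : Fin n → Γ} {B : Block n}

/-- All columns are intervals of the same height with the rows in the same order: by induction a
column is a run of one character, and LF keeps such a run contiguous. -/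
theorem IsBlock.iterate_val (hB : IsBlock L B) {x : ℕ} (hx : x ≤ B.d) {k : Fin n}
    (hk : k ∈ Set.Icc B.i B.j) :
    ((lfMapping L)^[x] k).val = ((lfMapping L)^[x] B.i).val + (k.val - B.i.val) := by
  have hk' := hk
  rw [Set.mem_Icc, Fin.le_def, Fin.le_def] at hk'
  induction x generalizing k with
  | zero => simp only [Function.iterate_zero, id]; omega
  | succ x ih =>
    rw [Function.iterate_succ_apply', Function.iterate_succ_apply']
    have h1 := ih (by omega) hk hk'
    rw [lfMapping_interval L (p := (lfMapping L)^[x] B.i) (q := (lfMapping L)^[x] k)]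
    · omega
    · rw [Fin.le_def]; omega
    · intro r hr
      rw [Set.mem_Icc, Fin.le_def, Fin.le_def] at hr
      -- The row through `r`, recovered from the distance of `r` to the head of its column.
      let k' : Fin n := ⟨B.i.val + (r.val - ((lfMapping L)^[x] B.i).val), by omega⟩
      have hk1 : k' ∈ Set.Icc B.i B.j := by
        rw [Set.mem_Icc, Fin.le_def, Fin.le_def]
        simp only [k']
        omega
      have h2 := ih (by omega) hk1 hk1
      have h3 : r = (lfMapping L)^[x] k' := Fin.ext (by rw [h2]; simp only [k']; omega)
      rw [h3]
      exact hB.2 x (by omega) k' hk1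

theorem IsBlock.exists_row (hB : IsBlock L B) {x : ℕ} (hx : x ≤ B.d) {p : Fin n}
    (hp : p ∈ column L B x) :
    ∃ k ∈ Set.Icc B.i B.j, p = (lfMapping L)^[x] k ∧
      k.val - B.i.val = p.val - ((lfMapping L)^[x] B.i).val := by
  have h1 := hB.iterate_val hx (k := B.j) ⟨hB.1, le_rfl⟩
  have h0 := hB.1
  rw [column, Set.mem_Icc] at hp
  simp only [Fin.le_def] at hp h0
  let k' : Fin n := ⟨B.i.val + (p.val - ((lfMapping L)^[x] B.i).val), by omega⟩
  have hk1 : k' ∈ Set.Icc B.i B.j := by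
    rw [Set.mem_Icc, Fin.le_def, Fin.le_def]
    simp only [k']
    omega
  have h2 := hB.iterate_val hx hk1
  simp only [k'] at h2
  refine ⟨k', hk1, Fin.ext ?_, ?_⟩
  · rw [hB.iterate_val hx hk1]; simp only [k']; omega
  · simp only [k']; omega

theorem IsBlock.mem_column (hB : IsBlock L B) {x : ℕ} (hx : x ≤ B.d) {k : Fin n}
    (hk : k ∈ Set.Icc B.i B.j) : (lfMapping L)^[x] k ∈ column L B x := by
  have h1 := hB.iterate_val hx (k := B.j) ⟨hB.1, le_rfl⟩
  have h2 := hB.iterate_val hx hk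
  rw [Set.mem_Icc] at hk
  rw [column, Set.mem_Icc]
  simp only [Fin.le_def] at hk ⊢
  omega

theorem IsBlock.mem_Ioc_iff (hB : IsBlock L B) {x : ℕ} (hx : x ≤ B.d) {p : Fin n} :
    p ∈ Set.Ioc ((lfMapping L)^[x] B.i) ((lfMapping L)^[x] B.j) ↔
      ∃ k ∈ Set.Ioc B.i B.j, p = (lfMapping L)^[x] k := by
  constructor
  · intro hp
    obtain ⟨k, hk, hk1, hk2⟩ := hB.exists_row hx (p := p) ⟨hp.1.le, hp.2⟩
    refine ⟨k, ⟨?_, hk.2⟩, hk1⟩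
    have := hp.1
    rw [Fin.lt_def] at this ⊢
    omega
  · rintro ⟨k, hk, rfl⟩
    have h1 := hB.iterate_val hx (k := B.j) ⟨hB.1, le_rfl⟩
    have h2 := hB.iterate_val hx (k := k) ⟨hk.1.le, hk.2⟩
    have h3 := hk.1
    have h4 := hk.2
    rw [Set.mem_Ioc]
    simp only [Fin.le_def, Fin.lt_def] at h3 h4 ⊢
    omega

theorem IsBlock.head_mem_column (hB : IsBlock L B) {x : ℕ} (hx : x ≤ B.d) :
    (lfMapping L)^[x] B.i ∈ column L B x :=
  hB.mem_column hx ⟨le_rfl, hB.1⟩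

theorem IsBlock.last_mem_column (hB : IsBlock L B) {x : ℕ} (hx : x ≤ B.d) :
    (lfMapping L)^[x] B.j ∈ column L B x :=
  hB.mem_column hx ⟨hB.1, le_rfl⟩

theorem IsBlock.head_lt_last (hB : IsBlock L B) {x : ℕ} (hx : x ≤ B.d) (h : B.i < B.j) :
    (lfMapping L)^[x] B.i < (lfMapping L)^[x] B.j := by
  have h1 := hB.iterate_val hx (k := B.j) ⟨hB.1, le_rfl⟩
  rw [Fin.lt_def] at h ⊢
  omega

theorem IsBlock.ncard_column (hB : IsBlock L B) {x : ℕ} (hx : x ≤ B.d) :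
    (column L B x).ncard = B.height := by
  have h1 := hB.iterate_val hx (k := B.j) ⟨hB.1, le_rfl⟩
  have h2 := hB.1
  rw [Fin.le_def] at h2
  rw [column, ← Finset.coe_Icc, Set.ncard_coe_finset, Fin.card_Icc, Block.height]
  omega

theorem mem_crossedL_iff {𝓑 : Set (Block n)} (h𝓑 : ∀ B ∈ 𝓑, IsBlock L B) {p : Fin n} :
    p ∈ crossedL L 𝓑 ↔ ∃ B ∈ 𝓑, ∃ x < B.d,
      p ∈ Set.Ioc ((lfMapping L)^[x] B.i) ((lfMapping L)^[x] B.j) := by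
  constructor
  · rintro ⟨B, hB, x, hx, h⟩
    exact ⟨B, hB, x, hx, ((h𝓑 B hB).mem_Ioc_iff hx.le).2 h⟩
  · rintro ⟨B, hB, x, hx, h⟩
    exact ⟨B, hB, x, hx, ((h𝓑 B hB).mem_Ioc_iff hx.le).1 h⟩

theorem mem_crossedF_iff {𝓑 : Set (Block n)} (h𝓑 : ∀ B ∈ 𝓑, IsBlock L B) {p : Fin n} :
    p ∈ crossedF L 𝓑 ↔ ∃ B ∈ 𝓑, ∃ x, 0 < x ∧ x ≤ B.d ∧
      p ∈ Set.Ioc ((lfMapping L)^[x] B.i) ((lfMapping L)^[x] B.j) := by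
  constructor
  · rintro ⟨B, hB, x, hx0, hx, h⟩
    exact ⟨B, hB, x, hx0, hx, ((h𝓑 B hB).mem_Ioc_iff hx).2 h⟩
  · rintro ⟨B, hB, x, hx0, hx, h⟩
    exact ⟨B, hB, x, hx0, hx, ((h𝓑 B hB).mem_Ioc_iff hx).1 h⟩

/-- The columns crossed out in F are those crossed out in L, moved on by one application of the
injective LF. -/
theorem lfMapping_mem_crossedF_iff {𝓑 : Set (Block n)} {p : Fin n} :
    lfMapping L p ∈ crossedF L 𝓑 ↔ p ∈ crossedL L 𝓑 := by
  constructor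
  · rintro ⟨B, hB, x, hx0, hx, k, hk, h⟩
    obtain ⟨x, rfl⟩ := Nat.exists_eq_succ_of_ne_zero hx0.ne'
    rw [Nat.succ_eq_add_one, Function.iterate_succ_apply'] at h
    exact ⟨B, hB, x, by omega, k, hk, lfMapping_injective L h⟩
  · rintro ⟨B, hB, x, hx, k, hk, rfl⟩
    exact ⟨B, hB, x + 1, by omega, by omega, k, hk, by rw [Function.iterate_succ_apply']⟩

theorem exists_pred_of_mem_crossedL {𝓑 : Set (Block n)} (h𝓑 : ∀ B ∈ 𝓑, IsBlock L B) {p : Fin n}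
    (hp : p ∈ crossedL L 𝓑) : ∃ q : Fin n, p.val = q.val + 1 ∧ L p = L q := by
  obtain ⟨B, hB, x, hx, k, hk, rfl⟩ := hp
  have hk1 := hk.1
  have hk2 := hk.2
  rw [Fin.lt_def] at hk1
  rw [Fin.le_def] at hk2
  let k' : Fin n := ⟨k.val - 1, by omega⟩
  have hk' : k' ∈ Set.Icc B.i B.j := by
    rw [Set.mem_Icc, Fin.le_def, Fin.le_def]; simp only [k']; omega
  refine ⟨(lfMapping L)^[x] k', ?_, ?_⟩
  · rw [(h𝓑 B hB).iterate_val hx.le hk', (h𝓑 B hB).iterate_val hx.le (k := k) ⟨hk.1.le, hk.2⟩]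
    simp only [k']
    omega
  · rw [(h𝓑 B hB).2 x hx.le k ⟨hk.1.le, hk.2⟩, (h𝓑 B hB).2 x hx.le k' hk']

end Columns

/-! ### Collisions -/

section Collisions

variable {L : Fin n → Γ}

/-- If the columns meet, the difference cannot have full size `I.height`; so the intersection has
`O.height` elements, as many as the column of `O`. -/
theorem CompensableAs.subset {I O : Block n} (h : CompensableAs L I O) (hI : IsBlock L I)
    (hO : IsBlock L O) {x x' : ℕ} (hx : x ≤ I.d) (hx' : x' ≤ O.d) {q : Fin n}
    (hq : q ∈ column L I x) (hq' : q ∈ column L O x') : column L O x' ⊆ column L I x := by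
  have h1 := Set.ncard_inter_add_ncard_sdiff_eq_ncard (column L I x) (column L O x')
    (Set.toFinite _)
  have h2 : 0 < (column L I x ∩ column L O x').ncard :=
    (Set.ncard_pos (Set.toFinite _)).2 ⟨q, hq, hq'⟩
  have hle := h.height_le
  rw [hI.ncard_column hx] at h1
  rcases h.proper_intersection x hx x' hx' with h3 | h3
  · omega
  · have h4 : column L I x ∩ column L O x' = column L O x' := by
      apply Set.eq_of_subset_of_ncard_le Set.inter_subset_right _ (Set.toFinite _)
      rw [hO.ncard_column hx']
      omega
    exact Set.inter_eq_right.1 h4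

/-- The unshared row of `I` passes through every column of `I` and avoids every column of `O`. -/
theorem CompensableAs.ne {I O : Block n} (h : CompensableAs L I O) (hI : IsBlock L I)
    {x x' : ℕ} (hx : x ≤ I.d) (hx' : x' ≤ O.d) : column L O x' ≠ column L I x := by
  intro heq
  obtain ⟨y, hy, hy'⟩ := h.row_unshared
  have := hI.mem_column hx hy
  exact hy' x hx ⟨⟨x, hx, this⟩, ⟨x', hx', heq ▸ this⟩⟩

variable {𝓑 : Set (Block n)} (h𝓑 : ∀ B ∈ 𝓑, IsBlock L B) (hC : NoCriticalCollisions L 𝓑)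

include hC in
theorem eq_of_mem_columns {B : Block n} (hB : B ∈ 𝓑) {x x' : ℕ} (hx : x ≤ B.d)
    (hx' : x' ≤ B.d) {q : Fin n} (hq : q ∈ column L B x) (hq' : q ∈ column L B x') :
    x = x' := by
  have h := hC.1 B hB
  rcases lt_trichotomy x x' with h1 | h1 | h1
  · exact (h ⟨x, hx, x', hx', h1, q, hq, hq'⟩).elim
  · exact h1
  · exact (h ⟨x', hx', x, hx, h1, q, hq', hq⟩).elim

include h𝓑 hC in
theorem column_subset_or_subset {B B' : Block n} (hB : B ∈ 𝓑) (hB' : B' ∈ 𝓑) {x x' : ℕ}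
    (hx : x ≤ B.d) (hx' : x' ≤ B'.d) {q : Fin n} (hq : q ∈ column L B x)
    (hq' : q ∈ column L B' x') :
    column L B' x' ⊆ column L B x ∨ column L B x ⊆ column L B' x' := by
  by_cases hne : B = B'
  · subst hne
    rw [eq_of_mem_columns hC hB hx hx' hq hq']
    exact Or.inl subset_rfl
  · rcases hC.2 B hB B' hB' hne ⟨x, hx, x', hx', q, hq, hq'⟩ with h | h
    · exact Or.inl (h.subset (h𝓑 B hB) (h𝓑 B' hB') hx hx' hq hq')
    · exact Or.inr (h.subset (h𝓑 B' hB') (h𝓑 B hB) hx' hx hq' hq)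

include h𝓑 hC in
/-- A block that meets the first or the last column of another block is the outer block of the
two, and meets it in a column that is neither its first nor its last one. -/
theorem eq_or_compensableAs_of_mem_end {B B' : Block n} (hB : B ∈ 𝓑) (hB' : B' ∈ 𝓑) {x x' : ℕ}
    (hx : x = 0 ∨ x = B.d) (hx' : x' ≤ B'.d) {q : Fin n} (hq : q ∈ column L B x)
    (hq' : q ∈ column L B' x') :
    (B' = B ∧ x' = x) ∨ (CompensableAs L B B' ∧ 0 < x' ∧ x' < B'.d ∧
      column L B' x' ⊆ column L B x ∧ column L B' x' ≠ column L B x) := by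
  have hxd : x ≤ B.d := by omega
  by_cases hne : B' = B
  · subst hne
    exact Or.inl ⟨rfl, eq_of_mem_columns hC hB hx' hxd hq' hq⟩
  · right
    rcases hC.2 B hB B' hB' (Ne.symm hne) ⟨x, hxd, x', hx', q, hq, hq'⟩ with h | h
    · refine ⟨h, ?_, ?_, h.subset (h𝓑 B hB) (h𝓑 B' hB') hxd hx' hq hq', h.ne (h𝓑 B hB) hxd hx'⟩
      · rcases Nat.eq_zero_or_pos x' with h0 | h0
        · subst h0
          exact (h.start_unshared q hq' ⟨⟨x, hxd, hq⟩, ⟨0, hx', hq'⟩⟩).elim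
        · exact h0
      · rcases hx'.eq_or_lt with h0 | h0
        · subst h0
          exact (h.end_unshared q hq' ⟨⟨x, hxd, hq⟩, ⟨_, le_rfl, hq'⟩⟩).elim
        · exact h0
    -- Here `B` would be the outer block, whose end columns contain no shared position.
    · rcases hx with rfl | rfl
      · exact (h.start_unshared q hq ⟨⟨x', hx', hq'⟩, ⟨0, hxd, hq⟩⟩).elim
      · exact (h.end_unshared q hq ⟨⟨x', hx', hq'⟩, ⟨_, le_rfl, hq⟩⟩).elim

/-- The positions outside the first rows of the blocks and strictly between the first and the last
columns. -/
def middle (L : Fin n → Γ) (𝓑 : Set (Block n)) : Set (Fin n) :=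
  {p | ∃ B ∈ 𝓑, ∃ x, 0 < x ∧ x < B.d ∧
    p ∈ Set.Ioc ((lfMapping L)^[x] B.i) ((lfMapping L)^[x] B.j)}

include h𝓑 in
theorem middle_subset_crossedL : middle L 𝓑 ⊆ crossedL L 𝓑 := by
  rintro p ⟨B, hB, x, hx0, hx, h⟩
  exact (mem_crossedL_iff h𝓑).2 ⟨B, hB, x, hx, h⟩

include h𝓑 in
theorem middle_subset_crossedF : middle L 𝓑 ⊆ crossedF L 𝓑 := by
  rintro p ⟨B, hB, x, hx0, hx, h⟩
  exact (mem_crossedF_iff h𝓑).2 ⟨B, hB, x, hx0, hx.le, h⟩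

include h𝓑 hC in
-- A position crossed out twice might lie in the first column of one block and a later column of
-- another. Then the second block is outer and is met strictly between its ends, so the position is
-- in a middle column all the same.
theorem mem_middle_iff {p : Fin n} :
    p ∈ middle L 𝓑 ↔ p ∈ crossedL L 𝓑 ∧ p ∈ crossedF L 𝓑 := by
  refine ⟨fun h => ⟨middle_subset_crossedL h𝓑 h, middle_subset_crossedF h𝓑 h⟩, ?_⟩
  rintro ⟨h1, h2⟩
  obtain ⟨B, hB, x, hx, h⟩ := (mem_crossedL_iff h𝓑).1 h1
  obtain ⟨B', hB', x', hx0', hx', h'⟩ := (mem_crossedF_iff h𝓑).1 h2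
  rcases Nat.eq_zero_or_pos x with rfl | hx0
  · rcases eq_or_compensableAs_of_mem_end h𝓑 hC hB hB' (Or.inl rfl) hx' (q := p)
      (Set.Ioc_subset_Icc_self h) (Set.Ioc_subset_Icc_self h') with h3 | h3
    · omega
    · exact ⟨B', hB', x', hx0', h3.2.2.1, h'⟩
  · exact ⟨B, hB, x, hx0, hx, h⟩

include h𝓑 hC in
-- A different block meeting an end column of `B` has its column inside that of `B`, so its head
-- cannot lie above the head of `B`. Thus the uppermost row of a tunnel is never crossed out at the
-- ends of the tunnel.
theorem head_notMem_Ioc {B B' : Block n} (hB : B ∈ 𝓑) (hB' : B' ∈ 𝓑) {x x' : ℕ}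
    (hx : x = 0 ∨ x = B.d) (hx' : x' ≤ B'.d) :
    (lfMapping L)^[x] B.i ∉
      Set.Ioc ((lfMapping L)^[x'] B'.i) ((lfMapping L)^[x'] B'.j) := by
  intro h
  rcases eq_or_compensableAs_of_mem_end h𝓑 hC hB hB' hx hx'
    ((h𝓑 B hB).head_mem_column (by omega)) (Set.Ioc_subset_Icc_self h) with ⟨rfl, rfl⟩ | h3
  · exact lt_irrefl _ h.1
  · exact absurd (h3.2.2.2.1 ((h𝓑 B' hB').head_mem_column hx')).1 (not_le.2 h.1)

include h𝓑 hC in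
/-- Not all rows but the first one of an end column of a block are crossed out by the middle
columns of other blocks. -/
theorem exists_mem_Ioc_notMem_middle {B : Block n} (hB : B ∈ 𝓑) (hij : B.i < B.j) {x : ℕ}
    (hx : x = 0 ∨ x = B.d) :
    ∃ r ∈ Set.Ioc ((lfMapping L)^[x] B.i) ((lfMapping L)^[x] B.j), r ∉ middle L 𝓑 := by
  by_contra hcon
  push Not at hcon
  have hxd : x ≤ B.d := by omega
  have hlt := (h𝓑 B hB).head_lt_last hxd hij
  set z := (lfMapping L)^[x] B.j with hz
  have hzB : z ∈ column L B x := (h𝓑 B hB).last_mem_column hxd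
  -- Infinite descent on the head of a middle column through the last row `z`. Being properly
  -- contained in the column of `B` and reaching `z`, it has a head strictly below that of `B`. By
  -- assumption that head is crossed out by a further middle column, which starts higher and, by
  -- nestedness, again contains `z`.
  have key : ∀ m : ℕ, ∀ B' ∈ 𝓑, ∀ x', 0 < x' → x' < B'.d →
      z ∈ Set.Ioc ((lfMapping L)^[x'] B'.i) ((lfMapping L)^[x'] B'.j) →
      ((lfMapping L)^[x'] B'.i).val = m → False := by
    intro m
    induction m using Nat.strong_induction_on with
    | _ m ih =>
      intro B' hB' x' hx0' hx' hzB' hm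
      have hd' : x' ≤ B'.d := hx'.le
      have hz' : z ∈ column L B' x' := Set.Ioc_subset_Icc_self hzB'
      have hhead := (h𝓑 B' hB').head_mem_column hd'
      rcases eq_or_compensableAs_of_mem_end h𝓑 hC hB hB' hx hd' hzB hz' with ⟨h1, h2⟩ | h3
      · subst h1; omega
      · obtain ⟨-, -, -, hsub, hne⟩ := h3
        have hge := hsub hhead
        rcases hge.1.eq_or_lt with heq | hgt
        · refine hne (hsub.antisymm ?_)
          intro w hw
          exact ⟨heq ▸ hw.1, hw.2.trans hzB'.2⟩
        · obtain ⟨B₂, hB₂, x₂, hx₂, hxd₂, h₂⟩ := hcon _ ⟨hgt, hge.2⟩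
          have hlt₂ : (lfMapping L)^[x₂] B₂.i < (lfMapping L)^[x'] B'.i := h₂.1
          rcases column_subset_or_subset h𝓑 hC hB' hB₂ hd' hxd₂.le hhead
            (Set.Ioc_subset_Icc_self h₂) with h4 | h4
          · exact absurd (h4 ((h𝓑 B₂ hB₂).head_mem_column hxd₂.le)).1 (not_le.2 hlt₂)
          · have h5 := h4 hz'
            exact ih _ (by rw [← hm]; exact hlt₂) B₂ hB₂ x₂ hx₂ hxd₂
              ⟨hlt₂.trans hzB'.1, h5.2⟩ rfl
  obtain ⟨B', hB', x', hx0', hx', h⟩ := hcon z ⟨hlt, le_rfl⟩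
  exact key _ B' hB' x' hx0' hx' h rfl

include h𝓑 hC in
/-- The rows of a block that are crossed out by the middle columns of other blocks are the same
in the first and in the last column. -/
theorem iterate_mem_middle_iff {B : Block n} (hB : B ∈ 𝓑) {k : Fin n}
    (hk : k ∈ Set.Icc B.i B.j) :
    (lfMapping L)^[B.d] k ∈ middle L 𝓑 ↔ k ∈ middle L 𝓑 := by
  have hinj : ∀ m, Function.Injective ((lfMapping L)^[m]) :=
    fun m => (lfMapping_injective L).iterate m
  constructor
  · rintro ⟨B', hB', x', hx0', hx', h⟩
    have hB'' := h𝓑 B' hB'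
    rcases eq_or_compensableAs_of_mem_end h𝓑 hC hB hB' (Or.inr rfl) hx'.le
      ((h𝓑 B hB).mem_column le_rfl hk) (Set.Ioc_subset_Icc_self h) with ⟨rfl, rfl⟩ | h3
    · omega
    · obtain ⟨k', hk', he⟩ := (hB''.mem_Ioc_iff hx'.le).1 h
      -- Otherwise, following the row back through `B`, one would reach the first column of `B'`
      -- while still inside `B`, and that column is unshared.
      have hlt : B.d < x' := by
        by_contra hle
        rw [not_lt] at hle
        obtain ⟨m, hm⟩ := Nat.exists_eq_add_of_le hle
        rw [hm, Function.iterate_add_apply] at he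
        have he' := hinj _ he
        have hk0 : k' ∈ column L B' 0 := hB''.mem_column (Nat.zero_le _) ⟨hk'.1.le, hk'.2⟩
        refine h3.1.start_unshared k' hk0 ⟨⟨m, by omega, ?_⟩, ⟨0, by omega, hk0⟩⟩
        rw [← he']
        exact (h𝓑 B hB).mem_column (by omega) hk
      obtain ⟨m, rfl⟩ := Nat.exists_eq_add_of_lt hlt
      rw [add_assoc, Function.iterate_add_apply] at he
      have he' := hinj _ he
      exact ⟨B', hB', m + 1, by omega, by omega,
        (hB''.mem_Ioc_iff (by omega)).2 ⟨k', hk', he'⟩⟩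
  · rintro ⟨B', hB', x', hx0', hx', h⟩
    have hB'' := h𝓑 B' hB'
    rcases eq_or_compensableAs_of_mem_end h𝓑 hC hB hB' (Or.inl rfl) hx'.le
      ((h𝓑 B hB).mem_column (Nat.zero_le _) hk) (Set.Ioc_subset_Icc_self h) with ⟨rfl, rfl⟩ | h3
    · omega
    · obtain ⟨k', hk', he⟩ := (hB''.mem_Ioc_iff hx'.le).1 h
      -- Otherwise, following the row forward, the last column of `B'` would be reached inside `B`.
      have hlt : B.d + x' < B'.d := by
        by_contra hle
        rw [not_lt] at hle
        obtain ⟨m, hm⟩ := Nat.exists_eq_add_of_lt hx'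
        have hk0 : (lfMapping L)^[B'.d] k' ∈ column L B' B'.d :=
          hB''.mem_column le_rfl ⟨hk'.1.le, hk'.2⟩
        refine h3.1.end_unshared _ hk0 ⟨⟨m + 1, by omega, ?_⟩, ⟨_, le_rfl, hk0⟩⟩
        have : (lfMapping L)^[B'.d] k' = (lfMapping L)^[m + 1] k := by
          rw [he, ← Function.iterate_add_apply]
          congr 2
          omega
        rw [this]
        exact (h𝓑 B hB).mem_column (by omega) hk
      refine ⟨B', hB', B.d + x', by omega, hlt, (hB''.mem_Ioc_iff hlt.le).2 ⟨k', hk', ?_⟩⟩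
      rw [he, ← Function.iterate_add_apply]

end Collisions

/-! ### Collapsing positions -/

open Classical in
/-- The last position up to `p` that does not belong to `C`. -/
noncomputable def lastOutside (C : Set (Fin n)) (p : Fin n) : Fin n :=
  if h : (Finset.univ.filter fun q => q ≤ p ∧ q ∉ C).Nonempty then
    (Finset.univ.filter fun q => q ≤ p ∧ q ∉ C).max' h
  else p

theorem lastOutside_spec {C : Set (Fin n)} (h0 : ∀ q ∈ C, 0 < q.val) (p : Fin n) :
    lastOutside C p ≤ p ∧ lastOutside C p ∉ C ∧
      ∀ r ∈ Set.Ioc (lastOutside C p) p, r ∈ C := by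
  classical
  -- Position 0 is outside `C`, so the default value in `lastOutside` does not occur.
  have hne : (Finset.univ.filter fun q => q ≤ p ∧ q ∉ C).Nonempty :=
    ⟨⟨0, by have := p.isLt; omega⟩, by
      simp only [Finset.mem_filter, Finset.mem_univ, true_and]
      exact ⟨by simp [Fin.le_def], fun h => by simpa using h0 _ h⟩⟩
  have hdef : lastOutside C p = (Finset.univ.filter fun q => q ≤ p ∧ q ∉ C).max' hne := by
    rw [lastOutside, dif_pos hne]
  have h1 := Finset.max'_mem _ hne
  rw [← hdef] at h1
  simp only [Finset.mem_filter, Finset.mem_univ, true_and] at h1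
  refine ⟨h1.1, h1.2, fun r hr => ?_⟩
  by_contra hrC
  have h2 := Finset.le_max' (Finset.univ.filter fun q => q ≤ p ∧ q ∉ C) r (by simp [hr.2, hrC])
  rw [← hdef] at h2
  exact absurd hr.1 (not_lt.2 h2)

theorem lastOutside_eq {C : Set (Fin n)} (h0 : ∀ q ∈ C, 0 < q.val) {p u : Fin n} (hup : u ≤ p)
    (hu : u ∉ C) (h : ∀ r ∈ Set.Ioc u p, r ∈ C) : lastOutside C p = u := by
  obtain ⟨h1, h2, h3⟩ := lastOutside_spec h0 p
  rcases lt_trichotomy (lastOutside C p) u with hlt | heq | hgt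
  · exact (hu (h3 u ⟨hlt, hup⟩)).elim
  · exact heq
  · exact (h2 (h _ ⟨hgt, h1⟩)).elim

/-- The first position after `u` outside `M` belongs to `C`. -/
def NextIn (M C : Set (Fin n)) (u : Fin n) : Prop :=
  ∃ r, u < r ∧ r ∉ M ∧ r ∈ C ∧ ∀ s, u < s → s < r → s ∈ M

theorem exists_next {M : Set (Fin n)} {u r : Fin n} (hur : u < r) (hr : r ∉ M) :
    ∃ r', u < r' ∧ r' ≤ r ∧ r' ∉ M ∧ ∀ s, u < s → s < r' → s ∈ M := by
  obtain ⟨r', h1, h2⟩ := WellFounded.has_min (wellFounded_lt (α := Fin n))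
    {r | u < r ∧ r ∉ M} ⟨r, hur, hr⟩
  refine ⟨r', h1.1, ?_, h1.2, fun s hs hs' => ?_⟩
  · exact not_lt.1 (h2 r ⟨hur, hr⟩)
  · by_contra hsM
    exact h2 s ⟨hs, hsM⟩ hs'

section

variable {L : Fin n → Γ} {𝓑 : Set (Block n)} (h𝓑 : ∀ B ∈ 𝓑, IsBlock L B)

include h𝓑 in
theorem pos_of_mem_crossedL : ∀ q ∈ crossedL L 𝓑, 0 < q.val := by
  intro q hq
  obtain ⟨q', h, -⟩ := exists_pred_of_mem_crossedL h𝓑 hq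
  omega

include h𝓑 in
theorem pos_of_mem_crossedF : ∀ q ∈ crossedF L 𝓑, 0 < q.val := by
  intro q hq
  obtain ⟨B, -, x, -, -, h⟩ := (mem_crossedF_iff h𝓑).1 hq
  have := h.1
  rw [Fin.lt_def] at this
  omega

include h𝓑 in
theorem pos_of_mem_middle : ∀ q ∈ middle L 𝓑, 0 < q.val :=
  fun q hq => pos_of_mem_crossedL h𝓑 q (middle_subset_crossedL h𝓑 hq)

include h𝓑 in
theorem apply_eq_of_Ioc_subset_crossedL {u p : Fin n} (hup : u ≤ p)
    (h : ∀ r ∈ Set.Ioc u p, r ∈ crossedL L 𝓑) : L p = L u := by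
  obtain ⟨m, hm⟩ : ∃ m, p.val = u.val + m := ⟨p.val - u.val, by rw [Fin.le_def] at hup; omega⟩
  induction m generalizing p with
  | zero => rw [Fin.ext hm]
  | succ m ih =>
    obtain ⟨q, hq, hL⟩ := exists_pred_of_mem_crossedL h𝓑
      (h p ⟨by rw [Fin.lt_def]; omega, le_rfl⟩)
    rw [hL]
    refine ih (by rw [Fin.le_def]; omega) (fun r hr => h r ⟨hr.1, ?_⟩) (by omega)
    have := hr.2
    rw [Fin.le_def] at this ⊢
    omega

include h𝓑 in
theorem apply_lastOutside_crossedL (p : Fin n) : L (lastOutside (crossedL L 𝓑) p) = L p := by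
  obtain ⟨h1, -, h3⟩ := lastOutside_spec (pos_of_mem_crossedL h𝓑) p
  exact (apply_eq_of_Ioc_subset_crossedL h𝓑 h1 h3).symm

include h𝓑 in
theorem apply_lastOutside_middle (p : Fin n) : L (lastOutside (middle L 𝓑) p) = L p := by
  obtain ⟨h1, -, h3⟩ := lastOutside_spec (pos_of_mem_middle h𝓑) p
  exact (apply_eq_of_Ioc_subset_crossedL h𝓑 h1
    (fun r hr => middle_subset_crossedL h𝓑 (h3 r hr))).symm

include h𝓑 in
-- From the last uncrossed position `u` to `p` all characters agree, so LF maps this interval onto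
-- an interval in order, and it turns crossed out in L into crossed out in F.
theorem lastOutside_crossedF_lfMapping (p : Fin n) :
    lastOutside (crossedF L 𝓑) (lfMapping L p) =
      lfMapping L (lastOutside (crossedL L 𝓑) p) := by
  obtain ⟨h1, h2, h3⟩ := lastOutside_spec (pos_of_mem_crossedL h𝓑) p
  set u := lastOutside (crossedL L 𝓑) p
  have hval : ∀ q, u ≤ q → q ≤ p →
      (lfMapping L q).val = (lfMapping L u).val + (q.val - u.val) := by
    intro q huq hqp
    apply lfMapping_interval L huq
    intro r hr
    exact apply_eq_of_Ioc_subset_crossedL h𝓑 hr.1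
      (fun s hs => h3 s ⟨hs.1, hs.2.trans (hr.2.trans hqp)⟩)
  have hp := hval p h1 le_rfl
  apply lastOutside_eq (pos_of_mem_crossedF h𝓑)
  · rw [Fin.le_def]; omega
  · rwa [lfMapping_mem_crossedF_iff]
  · intro w hw
    have hw1 := hw.1
    have hw2 := hw.2
    rw [Fin.lt_def] at hw1
    rw [Fin.le_def] at hw2 h1
    let q : Fin n := ⟨u.val + (w.val - (lfMapping L u).val), by omega⟩
    have hq1 : u < q := by rw [Fin.lt_def]; simp only [q]; omega
    have hq2 : q ≤ p := by rw [Fin.le_def]; simp only [q]; omega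
    have hwq : w = lfMapping L q := by
      apply Fin.ext
      rw [hval q hq1.le hq2]
      simp only [q]
      omega
    rw [hwq, lfMapping_mem_crossedF_iff]
    exact h3 q ⟨hq1, hq2⟩

/-! ### Starts and ends of tunnels, treated alike -/

variable (hC : NoCriticalCollisions L 𝓑)

/-- `C` consists of the middle positions and of the positions outside the first row in the columns
number `e B` of the blocks `B`. -/
def IsCrossedAt (L : Fin n → Γ) (𝓑 : Set (Block n)) (e : Block n → ℕ) (C : Set (Fin n)) : Prop :=
  (∀ B, e B = 0 ∨ e B = B.d) ∧ ∀ p, p ∈ C ↔ p ∈ middle L 𝓑 ∨ ∃ B ∈ 𝓑, 0 < B.d ∧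
    p ∈ Set.Ioc ((lfMapping L)^[e B] B.i) ((lfMapping L)^[e B] B.j)

include h𝓑 in
theorem isCrossedAt_crossedL : IsCrossedAt L 𝓑 (fun _ => 0) (crossedL L 𝓑) := by
  refine ⟨fun _ => Or.inl rfl, fun p => ?_⟩
  rw [mem_crossedL_iff h𝓑]
  constructor
  · rintro ⟨B, hB, x, hx, h⟩
    rcases Nat.eq_zero_or_pos x with rfl | hx0
    · exact Or.inr ⟨B, hB, hx, h⟩
    · exact Or.inl ⟨B, hB, x, hx0, hx, h⟩
  · rintro (⟨B, hB, x, hx0, hx, h⟩ | ⟨B, hB, hd, h⟩)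
    · exact ⟨B, hB, x, hx, h⟩
    · exact ⟨B, hB, 0, hd, h⟩

include h𝓑 in
theorem isCrossedAt_crossedF : IsCrossedAt L 𝓑 (fun B => B.d) (crossedF L 𝓑) := by
  refine ⟨fun _ => Or.inr rfl, fun p => ?_⟩
  rw [mem_crossedF_iff h𝓑]
  constructor
  · rintro ⟨B, hB, x, hx0, hx, h⟩
    rcases hx.eq_or_lt with rfl | hx
    · exact Or.inr ⟨B, hB, hx0, h⟩
    · exact Or.inl ⟨B, hB, x, hx0, hx, h⟩
  · rintro (⟨B, hB, x, hx0, hx, h⟩ | ⟨B, hB, hd, h⟩)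
    · exact ⟨B, hB, x, hx0, hx.le, h⟩
    · exact ⟨B, hB, B.d, hd, le_rfl, h⟩

variable {e : Block n → ℕ} {C : Set (Fin n)} (he : IsCrossedAt L 𝓑 e C)

include he in
theorem IsCrossedAt.pos : ∀ q ∈ C, 0 < q.val := by
  intro q hq
  rcases (he.2 q).1 hq with ⟨B, -, x, -, -, h⟩ | ⟨B, -, -, h⟩ <;>
  · have := h.1
    rw [Fin.lt_def] at this
    omega

include he in
theorem IsCrossedAt.exists_column {q : Fin n} (hq : q ∈ C) : ∃ B ∈ 𝓑, ∃ x ≤ B.d,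
    q ∈ Set.Ioc ((lfMapping L)^[x] B.i) ((lfMapping L)^[x] B.j) := by
  rcases (he.2 q).1 hq with ⟨B, hB, x, -, hx, h⟩ | ⟨B, hB, -, h⟩
  · exact ⟨B, hB, x, hx.le, h⟩
  · exact ⟨B, hB, e B, by rcases he.1 B with h | h <;> omega, h⟩

include h𝓑 hC he in
-- The head is not in `C` by `head_notMem_Ioc`, while all lower rows of the column are.
theorem IsCrossedAt.lastOutside_eq_head {B : Block n} (hB : B ∈ 𝓑) (hd : 0 < B.d) {p : Fin n}
    (hp : p ∈ column L B (e B)) : lastOutside C p = (lfMapping L)^[e B] B.i := by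
  apply lastOutside_eq he.pos hp.1
  · intro h
    obtain ⟨B', hB', x', hx', h'⟩ := he.exists_column h
    exact head_notMem_Ioc h𝓑 hC hB hB' (he.1 B) hx' h'
  · intro r hr
    exact (he.2 r).2 (Or.inr ⟨B, hB, hd, hr.1, hr.2.trans hp.2⟩)

include h𝓑 hC he in
/-- A tunnel starts or ends at `p` if and only if the next remaining position after the
uppermost row is crossed out. -/
theorem IsCrossedAt.nextIn_iff (p : Fin n) :
    NextIn (middle L 𝓑) C (lastOutside C p) ↔
      ∃ B ∈ 𝓑, 0 < B.d ∧ B.i < B.j ∧ p ∈ column L B (e B) := by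
  have hed : ∀ B, e B ≤ B.d := fun B => by rcases he.1 B with h | h <;> omega
  constructor
  · rintro ⟨r, hur, hrM, hrC, hmin⟩
    rcases (he.2 r).1 hrC with h | ⟨B, hB, hd, hr⟩
    · exact (hrM h).elim
    obtain ⟨hup, -, hin⟩ := lastOutside_spec he.pos p
    set u := lastOutside C p
    refine ⟨B, hB, hd, ?_, ?_, ?_⟩
    · obtain ⟨k, hk, -⟩ := ((h𝓑 B hB).mem_Ioc_iff (hed B)).1 hr
      exact hk.1.trans_le hk.2
    · have hu : (lfMapping L)^[e B] B.i ≤ u := by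
        by_contra hlt
        obtain ⟨B', hB', x', -, hx', h'⟩ := hmin _ (not_le.1 hlt) hr.1
        exact head_notMem_Ioc h𝓑 hC hB hB' (he.1 B) hx'.le h'
      exact hu.trans hup
    -- If `p` lay beyond the last row `z`, the position after `z` would be in `C`, as a non-head row
    -- of some column. That column then contains `z` too, so it lies inside the column of `B`, which
    -- ends at `z`.
    · by_contra hlt
      rw [not_le] at hlt
      set z := (lfMapping L)^[e B] B.j with hz
      have hzB : z ∈ column L B (e B) := (h𝓑 B hB).last_mem_column (hed B)
      have hrz := hr.2
      simp only [Fin.lt_def, Fin.le_def] at hlt hur hrz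
      let z' : Fin n := ⟨z.val + 1, by omega⟩
      have hz' : z' ∈ C := hin z' ⟨by rw [Fin.lt_def]; simp only [z']; omega,
        by rw [Fin.le_def]; simp only [z']; omega⟩
      have hz'B : z' ∉ column L B (e B) := by
        intro h
        have := h.2
        rw [Fin.le_def] at this
        simp only [z'] at this
        omega
      obtain ⟨B', hB', x', hx', h'⟩ := he.exists_column hz'
      have hz'B' := Set.Ioc_subset_Icc_self h'
      have hzB' : z ∈ column L B' x' := by
        have h1 := h'.1
        have h2 := h'.2
        rw [column, Set.mem_Icc]
        simp only [Fin.lt_def, Fin.le_def, z'] at h1 h2 ⊢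
        omega
      rcases eq_or_compensableAs_of_mem_end h𝓑 hC hB hB' (he.1 B) hx' hzB hzB' with
        ⟨rfl, rfl⟩ | h3
      · exact hz'B hz'B'
      · exact hz'B (h3.2.2.2.1 hz'B')
  · rintro ⟨B, hB, hd, hij, hp⟩
    rw [he.lastOutside_eq_head h𝓑 hC hB hd hp]
    obtain ⟨r, hr, hrM⟩ := exists_mem_Ioc_notMem_middle h𝓑 hC hB hij (he.1 B)
    obtain ⟨r', h1, h2, h3, h4⟩ := exists_next hr.1 hrM
    exact ⟨r', h1, h3, (he.2 r').2 (Or.inr ⟨B, hB, hd, h1, h2.trans hr.2⟩), h4⟩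

open Classical in
/-- The number of remaining positions after the uppermost row, up to `p`. -/
noncomputable def tunnelOffset (L : Fin n → Γ) (𝓑 : Set (Block n)) (C : Set (Fin n))
    (p : Fin n) : ℕ :=
  (Finset.univ.filter fun r => r ∉ middle L 𝓑 ∧ lastOutside C p < r ∧ r ≤ p).card

include h𝓑 hC in
-- `LF^d` carries the rows from the head down to `k` to those of the last column, in order and
-- respecting `middle`. This is why the offset pushed on entry is the right one on leaving.
theorem tunnelOffset_crossedF_eq {B : Block n} (hB : B ∈ 𝓑) (hd : 0 < B.d) {k : Fin n}
    (hk : k ∈ Set.Icc B.i B.j) :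
    tunnelOffset L 𝓑 (crossedF L 𝓑) ((lfMapping L)^[B.d] k) =
      tunnelOffset L 𝓑 (crossedL L 𝓑) k := by
  have hB' := h𝓑 B hB
  have h1 := (isCrossedAt_crossedF h𝓑).lastOutside_eq_head h𝓑 hC hB hd
    (hB'.mem_column le_rfl hk)
  have h2 := (isCrossedAt_crossedL h𝓑).lastOutside_eq_head h𝓑 hC hB hd
    (hB'.mem_column (Nat.zero_le _) hk)
  simp only [Function.iterate_zero, id] at h1 h2
  unfold tunnelOffset
  rw [h1, h2]
  have hkval := hB'.iterate_val le_rfl hk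
  symm
  refine Finset.card_bij (fun r _ => (lfMapping L)^[B.d] r) ?_ ?_ ?_
  · intro r hr
    simp only [Finset.mem_filter, Finset.mem_univ, true_and] at hr ⊢
    obtain ⟨hr1, hr2, hr3⟩ := hr
    have hrB : r ∈ Set.Icc B.i B.j := ⟨hr2.le, hr3.trans hk.2⟩
    have hrval := hB'.iterate_val le_rfl hrB
    refine ⟨by rwa [iterate_mem_middle_iff h𝓑 hC hB hrB], ?_, ?_⟩
    · rw [Fin.lt_def] at hr2 ⊢; omega
    · rw [Fin.le_def] at hr3 ⊢; omega
  · intro r _ r' _ h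
    exact (lfMapping_injective L).iterate _ h
  · intro w hw
    simp only [Finset.mem_filter, Finset.mem_univ, true_and] at hw
    obtain ⟨hw1, hw2, hw3⟩ := hw
    obtain ⟨r, hr, rfl, hr'⟩ := hB'.exists_row le_rfl (p := w)
      ⟨hw2.le, hw3.trans (hB'.mem_column le_rfl hk).2⟩
    rw [iterate_mem_middle_iff h𝓑 hC hB hr] at hw1
    have hri := hr.1
    have hki := hk.1
    refine ⟨r, ?_, rfl⟩
    simp only [Finset.mem_filter, Finset.mem_univ, true_and]
    rw [Fin.lt_def] at hw2 ⊢
    rw [Fin.le_def] at hw3 hri hki ⊢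
    exact ⟨hw1, by omega, by omega⟩

end

/-! ### Nested intervals -/

section Nested

variable {e : ℕ → ℕ}

theorem filter_range_succ (t : ℕ) :
    (List.range (t + 1)).reverse.filter (fun s => t + 1 ≤ e s) =
      if t < e t then t :: (List.range t).reverse.filter (fun s => t < e s)
      else (List.range t).reverse.filter (fun s => t < e s) := by
  rw [List.range_succ, List.reverse_append, List.reverse_singleton, List.singleton_append,
    List.filter_cons]
  simp only [Nat.succ_le_iff, decide_eq_true_eq]

theorem filter_range_of_forall_ne {t : ℕ} (h : ∀ s < t, e s ≠ t) :
    (List.range t).reverse.filter (fun s => t ≤ e s) =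
      (List.range t).reverse.filter (fun s => t < e s) := by
  apply List.filter_congr
  intro s hs
  have := h s (by simpa using hs)
  simp only [decide_eq_decide]
  omega

/-- Read `[s, e s]` as the time a tunnel is open. Tunnels opened after `s` have closed before `t`,
and those opened earlier and still open close strictly after `t`. So `s` heads the list, newest
first, and is the only entry removed at time `t`. -/
theorem filter_range_of_eq (hnest : ∀ s s', s < s' → s' ≤ e s → s' < e s' → e s' < e s)
    {s t : ℕ} (hst : s < t) (hs : e s = t) :
    (List.range t).reverse.filter (fun s => t ≤ e s) =
      s :: (List.range t).reverse.filter (fun s => t < e s) := by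
  obtain ⟨m, hm⟩ : ∃ m, t = s + 1 + m := ⟨t - (s + 1), by omega⟩
  suffices h : ∀ m, s + 1 + m ≤ t →
      (List.range (s + 1 + m)).reverse.filter (fun s => t ≤ e s) =
        s :: (List.range (s + 1 + m)).reverse.filter (fun s => t < e s) by
    have := h m hm.ge
    rwa [← hm] at this
  intro m hm
  induction m with
  | zero =>
    rw [Nat.add_zero, List.range_succ, List.reverse_append, List.reverse_singleton,
      List.singleton_append, List.filter_cons, List.filter_cons]
    simp only [hs, le_refl, decide_true, if_true, lt_irrefl, decide_false, Bool.false_eq_true,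
      if_false, List.cons.injEq, true_and]
    apply List.filter_congr
    intro r hr
    have hr' : r < s := by simpa using hr
    have := hnest r s hr'
    simp only [decide_eq_decide]
    omega
  | succ m ih =>
    have hlt : e (s + 1 + m) < t := by
      have := hnest s (s + 1 + m) (by omega)
      omega
    rw [← Nat.add_assoc, List.range_succ, List.reverse_append, List.reverse_singleton,
      List.singleton_append, List.filter_cons, List.filter_cons,
      if_neg (by simpa using hlt), if_neg (by simpa using hlt.le)]
    exact ih (by omega)

end Nested

/-! ### The tunneled Burrows-Wheeler transform -/

theorem find?_eq_some_of_pairwise {α : Type*} {R : α → α → Prop} {l : List α} {P : α → Bool}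
    {a : α} (hl : l.Pairwise R) (hal : a ∈ l) (ha : P a = true)
    (h : ∀ x, R x a → P x = false) : l.find? P = some a := by
  obtain ⟨l₁, l₂, rfl⟩ := List.append_of_mem hal
  rw [List.find?_eq_some_iff_append]
  refine ⟨ha, l₁, l₂, rfl, fun x hx => ?_⟩
  rw [List.pairwise_append] at hl
  simp [h x (hl.2.2 x hx a (by simp))]

/-- The count of ones up to a position is strictly smaller at every position before the one at `p`,
so the search cannot stop earlier. -/
theorem selectOne_eq_some {b : Fin n → Bool} {p : Fin n} (hp : b p = true) :
    selectOne b (Finset.univ.filter fun q => q ≤ p ∧ b q = true).card = some p := by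
  refine find?_eq_some_of_pairwise (List.pairwise_lt_finRange n) (List.mem_finRange p)
    (by simp [hp]) fun x hx => ?_
  simp only [Bool.and_eq_false_iff, decide_eq_false_iff_not]
  right
  refine (Finset.card_lt_card ?_).ne
  rw [Finset.ssubset_iff_of_subset]
  · exact ⟨p, by simp [hp], by simp [hx]⟩
  · intro q hq
    simp only [Finset.mem_filter, Finset.mem_univ, true_and] at hq ⊢
    exact ⟨hq.1.trans hx.le, hq.2⟩

section

variable (L : Fin n → Γ) (𝓑 : Set (Block n))

/-- The position in the original transform of a position in the tunneled one. -/
noncomputable def origin : Fin (tunnel L 𝓑).size ↪o Fin n :=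
  (remaining L 𝓑).orderEmbOfFin rfl

variable {L 𝓑} (h𝓑 : ∀ B ∈ 𝓑, IsBlock L B) (hC : NoCriticalCollisions L 𝓑)

include h𝓑 hC in
theorem exists_origin_eq_iff {q : Fin n} : (∃ a, origin L 𝓑 a = q) ↔ q ∉ middle L 𝓑 := by
  classical
  have h : Set.range (origin L 𝓑) = remaining L 𝓑 := Finset.range_orderEmbOfFin _ _
  rw [← Set.mem_range, h, mem_middle_iff h𝓑 hC, Finset.mem_coe, remaining, Finset.mem_filter]
  simp

theorem tunnel_L_apply (a : Fin (tunnel L 𝓑).size) :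
    (tunnel L 𝓑).L a = L (origin L 𝓑 a) := rfl

theorem tunnel_cntL_apply (a : Fin (tunnel L 𝓑).size) :
    (tunnel L 𝓑).cntL a = true ↔ origin L 𝓑 a ∉ crossedL L 𝓑 := by
  simp only [tunnel, origin, decide_eq_true_eq]
  rfl

theorem tunnel_cntF_apply (a : Fin (tunnel L 𝓑).size) :
    (tunnel L 𝓑).cntF a = true ↔ origin L 𝓑 a ∉ crossedF L 𝓑 := by
  simp only [tunnel, origin, decide_eq_true_eq]
  rfl

include h𝓑 hC in
-- Neighbours in the tunneled transform are consecutive positions outside `middle`. The bit 1 beyond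
-- the end matches the absence of a further such position.
theorem bitAt_succ_eq_false_iff {C : Set (Fin n)} {b : Fin (tunnel L 𝓑).size → Bool}
    (hb : ∀ a, b a = true ↔ origin L 𝓑 a ∉ C) (a : Fin (tunnel L 𝓑).size) :
    bitAt b (a + 1) = false ↔ NextIn (middle L 𝓑) C (origin L 𝓑 a) := by
  unfold bitAt
  split_ifs with h
  · constructor
    · intro hf
      have h1 : origin L 𝓑 ⟨a + 1, h⟩ ∈ C := by
        by_contra hcon
        rw [← hb, hf] at hcon
        exact Bool.false_ne_true hcon
      refine ⟨_, ?_, (exists_origin_eq_iff h𝓑 hC).1 ⟨_, rfl⟩, h1, fun s hs hs' => ?_⟩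
      · rw [(origin L 𝓑).lt_iff_lt, Fin.lt_def]; simp
      · by_contra hsM
        obtain ⟨c, rfl⟩ := (exists_origin_eq_iff h𝓑 hC).2 hsM
        rw [(origin L 𝓑).lt_iff_lt, Fin.lt_def] at hs hs'
        simp only at hs'
        omega
    · rintro ⟨r, hr, hrM, hrC, hmin⟩
      obtain ⟨c, rfl⟩ := (exists_origin_eq_iff h𝓑 hC).2 hrM
      rw [(origin L 𝓑).lt_iff_lt] at hr
      have hc : c = ⟨a + 1, h⟩ := by
        by_contra hne
        have hlt : (⟨a + 1, h⟩ : Fin (tunnel L 𝓑).size) < c := by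
          rw [Fin.lt_def] at hr ⊢
          have : c.val ≠ a.val + 1 := fun h' => hne (Fin.ext h')
          simp only
          omega
        have h1 := hmin (origin L 𝓑 ⟨a + 1, h⟩)
          ((origin L 𝓑).lt_iff_lt.2 (by rw [Fin.lt_def]; simp)) ((origin L 𝓑).lt_iff_lt.2 hlt)
        exact (exists_origin_eq_iff h𝓑 hC).1 ⟨_, rfl⟩ h1
      rw [← hc, ← Bool.not_eq_true, hb]
      simpa using hrC
  · simp only [false_iff]
    rintro ⟨r, hr, hrM, -⟩
    obtain ⟨c, rfl⟩ := (exists_origin_eq_iff h𝓑 hC).2 hrM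
    rw [(origin L 𝓑).lt_iff_lt, Fin.lt_def] at hr
    have := c.isLt
    omega

include h𝓑 hC in
theorem card_filter_origin (P : Fin n → Prop) [DecidablePred P] (hP : ∀ q, P q → q ∉ middle L 𝓑) :
    (Finset.univ.filter fun a => P (origin L 𝓑 a)).card = (Finset.univ.filter P).card := by
  refine Finset.card_bij (fun a _ => origin L 𝓑 a) ?_ ?_ ?_
  · intro a ha
    simpa using ha
  · intro a _ b _ h
    exact (origin L 𝓑).injective h
  · intro q hq
    rw [Finset.mem_filter] at hq
    obtain ⟨a, rfl⟩ := (exists_origin_eq_iff h𝓑 hC).2 (hP q hq.2)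
    exact ⟨a, by simpa using hq.2, rfl⟩

theorem lastOutside_mono {M C : Set (Fin n)} (hMC : M ⊆ C) (h0 : ∀ q ∈ C, 0 < q.val)
    (p : Fin n) : lastOutside C p ≤ lastOutside M p := by
  by_contra hlt
  rw [not_le] at hlt
  have h1 := lastOutside_spec h0 p
  have h2 := lastOutside_spec (fun q hq => h0 q (hMC hq)) p
  exact h1.2.1 (hMC (h2.2.2 _ ⟨hlt, h1.1⟩))

include h𝓑 hC in
-- The remaining positions counted by the offset are those with indices in `(a, b]`: nothing remains
-- between `lastOutside (middle L 𝓑) p` and `p`.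
theorem val_eq_add_tunnelOffset {C : Set (Fin n)} (hMC : middle L 𝓑 ⊆ C)
    (h0 : ∀ q ∈ C, 0 < q.val) {p : Fin n} {a b : Fin (tunnel L 𝓑).size}
    (ha : origin L 𝓑 a = lastOutside C p) (hb : origin L 𝓑 b = lastOutside (middle L 𝓑) p) :
    b.val = a.val + tunnelOffset L 𝓑 C p := by
  classical
  have hab : a ≤ b := by
    rw [← (origin L 𝓑).le_iff_le, ha, hb]
    exact lastOutside_mono hMC h0 p
  have h2 := lastOutside_spec (pos_of_mem_middle h𝓑) p
  have h3 : tunnelOffset L 𝓑 C p = (Finset.Ioc a b).card := by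
    unfold tunnelOffset
    rw [← card_filter_origin h𝓑 hC _ (fun q hq => hq.1)]
    congr 1
    ext c
    simp only [Finset.mem_filter, Finset.mem_univ, true_and, Finset.mem_Ioc]
    rw [← ha, (origin L 𝓑).lt_iff_lt]
    have hc : origin L 𝓑 c ∉ middle L 𝓑 := (exists_origin_eq_iff h𝓑 hC).1 ⟨c, rfl⟩
    constructor
    · rintro ⟨-, h4, h5⟩
      refine ⟨h4, ?_⟩
      rw [← (origin L 𝓑).le_iff_le, hb]
      by_contra hlt
      exact hc (h2.2.2 _ ⟨not_le.1 hlt, h5⟩)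
    · rintro ⟨h4, h5⟩
      rw [← (origin L 𝓑).le_iff_le, hb] at h5
      exact ⟨hc, h4, h5.trans h2.1⟩
  rw [h3, Fin.card_Ioc]
  rw [Fin.le_def] at hab
  omega

include h𝓑 in
theorem uppermost_eq_some {p : Fin n} {a b : Fin (tunnel L 𝓑).size}
    (ha : origin L 𝓑 a = lastOutside (crossedL L 𝓑) p)
    (hb : origin L 𝓑 b = lastOutside (middle L 𝓑) p) :
    uppermost (tunnel L 𝓑) b = some a := by
  have h1 := lastOutside_spec (pos_of_mem_crossedL h𝓑) p
  have h2 := lastOutside_spec (pos_of_mem_middle h𝓑) p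
  refine find?_eq_some_of_pairwise (R := fun x y => y < x)
    (List.pairwise_reverse.2 (List.pairwise_lt_finRange _))
    (List.mem_reverse.2 (List.mem_finRange a)) ?_ fun x hx => ?_
  · simp only [Bool.and_eq_true, decide_eq_true_eq, tunnel_cntL_apply, ha]
    refine ⟨?_, h1.2.1⟩
    rw [← (origin L 𝓑).le_iff_le, ha, hb]
    exact lastOutside_mono (middle_subset_crossedL h𝓑) (pos_of_mem_crossedL h𝓑) p
  · by_contra hcon
    simp only [Bool.not_eq_false, Bool.and_eq_true, decide_eq_true_eq, tunnel_cntL_apply] at hcon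
    obtain ⟨h3, h4⟩ := hcon
    rw [← (origin L 𝓑).lt_iff_lt, ha] at hx
    rw [← (origin L 𝓑).le_iff_le, hb] at h3
    exact h4 (h1.2.2 _ ⟨hx, h3.trans h2.1⟩)

include h𝓑 hC in
-- LF is a bijection from the positions not crossed out in L that weakly precede `u` in the order by
-- character and position, to those not crossed out in F up to `LF u`. Counting up to `b` instead of
-- up to `u` changes nothing, as everything between is crossed out in L.
theorem generalizedLF_eq_some {p : Fin n} {a b : Fin (tunnel L 𝓑).size}
    (ha : origin L 𝓑 a = lfMapping L (lastOutside (crossedL L 𝓑) p))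
    (hb : origin L 𝓑 b = lastOutside (middle L 𝓑) p) :
    generalizedLF (tunnel L 𝓑) b = some a := by
  classical
  have h1 := lastOutside_spec (pos_of_mem_crossedL h𝓑) p
  have h2 := lastOutside_spec (pos_of_mem_middle h𝓑) p
  have hle := lastOutside_mono (middle_subset_crossedL h𝓑) (pos_of_mem_crossedL h𝓑) p
  have hLu := apply_lastOutside_crossedL h𝓑 p
  have hLm := apply_lastOutside_middle h𝓑 p
  set u := lastOutside (crossedL L 𝓑) p
  set m := lastOutside (middle L 𝓑) p
  have hfu : lfMapping L u ∉ crossedF L 𝓑 := by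
    rw [lfMapping_mem_crossedF_iff]; exact h1.2.1
  have hcnt : (tunnel L 𝓑).cntF a = true := by
    rw [tunnel_cntF_apply, ha]; exact hfu
  rw [generalizedLF]
  convert selectOne_eq_some hcnt using 2
  rw [← Finset.card_union_of_disjoint]
  · rw [← Finset.filter_or]
    have e1 : (Finset.univ.filter fun q => q ≤ a ∧ (tunnel L 𝓑).cntF q = true).card =
        (Finset.univ.filter fun w => w ≤ lfMapping L u ∧ w ∉ crossedF L 𝓑).card := by
      rw [← card_filter_origin h𝓑 hC _
        (fun q hq h => hq.2 (middle_subset_crossedF h𝓑 h))]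
      congr 1
      ext c
      simp only [Finset.mem_filter, Finset.mem_univ, true_and, tunnel_cntF_apply]
      rw [← ha, (origin L 𝓑).le_iff_le]
    have e2 : (Finset.univ.filter fun q =>
          ((tunnel L 𝓑).cntL q = true ∧ (tunnel L 𝓑).L q < (tunnel L 𝓑).L b) ∨
          (q ≤ b ∧ (tunnel L 𝓑).cntL q = true ∧ (tunnel L 𝓑).L q = (tunnel L 𝓑).L b)).card =
        (Finset.univ.filter fun w => w ∉ crossedL L 𝓑 ∧
          (L w < L u ∨ (w ≤ u ∧ L w = L u))).card := by
      rw [← card_filter_origin h𝓑 hC _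
        (fun q hq h => hq.1 (middle_subset_crossedL h𝓑 h))]
      congr 1
      ext c
      simp only [Finset.mem_filter, Finset.mem_univ, true_and, tunnel_cntL_apply, tunnel_L_apply]
      rw [hb, hLm, ← hLu, ← (origin L 𝓑).le_iff_le, hb]
      constructor
      · rintro (⟨h3, h4⟩ | ⟨h3, h4, h5⟩)
        · exact ⟨h3, Or.inl h4⟩
        · refine ⟨h4, Or.inr ⟨?_, h5⟩⟩
          by_contra hlt
          exact h4 (h1.2.2 _ ⟨not_le.1 hlt, h3.trans h2.1⟩)
      · rintro ⟨h3, h4 | ⟨h4, h5⟩⟩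
        · exact Or.inl ⟨h3, h4⟩
        · exact Or.inr ⟨h4.trans hle, h3, h5⟩
    rw [e1, e2]
    have hiff : ∀ w, lfMapping L w ≤ lfMapping L u ↔ L w < L u ∨ (w ≤ u ∧ L w = L u) := by
      intro w
      rw [le_iff_lt_or_eq, (lfMapping_injective L).eq_iff, lfMapping_lt_iff, le_iff_lt_or_eq]
      constructor
      · rintro ((h | ⟨h, h'⟩) | rfl)
        · exact Or.inl h
        · exact Or.inr ⟨Or.inl h', h⟩
        · exact Or.inr ⟨Or.inr rfl, rfl⟩
      · rintro (h | ⟨h | h, h'⟩)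
        · exact Or.inl (Or.inl h)
        · exact Or.inl (Or.inr ⟨h', h⟩)
        · exact Or.inr h
    refine Finset.card_bij (fun w _ => lfMapping L w) ?_ ?_ ?_
    · intro w hw
      simp only [Finset.mem_filter, Finset.mem_univ, true_and] at hw ⊢
      rw [hiff, lfMapping_mem_crossedF_iff]
      exact ⟨hw.2, hw.1⟩
    · intro w _ w' _ h
      exact lfMapping_injective L h
    · intro w hw
      obtain ⟨w, rfl⟩ := lfMapping_surjective L w
      simp only [Finset.mem_filter, Finset.mem_univ, true_and] at hw
      rw [hiff, lfMapping_mem_crossedF_iff] at hw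
      exact ⟨w, by simpa using ⟨hw.2, hw.1⟩, rfl⟩
  · rw [Finset.disjoint_left]
    intro q hq hq'
    simp only [Finset.mem_filter, Finset.mem_univ, true_and] at hq hq'
    exact hq.2.ne hq'.2.2

include h𝓑 in
-- The algorithm tests the bits at its current row, not at the uppermost one. If the two rows
-- differ, the current row is itself crossed out, and so is the first remaining position after the
-- uppermost row.
theorem mem_or_nextIn_iff (p : Fin n) :
    (lastOutside (middle L 𝓑) p ∈ crossedL L 𝓑 ∨
        NextIn (middle L 𝓑) (crossedL L 𝓑) (lastOutside (middle L 𝓑) p)) ↔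
      NextIn (middle L 𝓑) (crossedL L 𝓑) (lastOutside (crossedL L 𝓑) p) := by
  have h1 := lastOutside_spec (pos_of_mem_crossedL h𝓑) p
  have h2 := lastOutside_spec (pos_of_mem_middle h𝓑) p
  rcases (lastOutside_mono (middle_subset_crossedL h𝓑) (pos_of_mem_crossedL h𝓑) p).eq_or_lt
    with heq | hlt
  · rw [← heq]
    exact ⟨fun h => h.resolve_left h1.2.1, Or.inr⟩
  · refine ⟨fun _ => ?_, fun _ => Or.inl (h1.2.2 _ ⟨hlt, h2.1⟩)⟩
    obtain ⟨r, h3, h4, h5, h6⟩ := exists_next hlt h2.2.1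
    exact ⟨r, h3, h5, h1.2.2 _ ⟨h3, h4.trans h2.1⟩, h6⟩

include h𝓑 hC in
theorem enterTunnel_eq_some {p : Fin n} {b : Fin (tunnel L 𝓑).size}
    (hb : origin L 𝓑 b = lastOutside (middle L 𝓑) p) (stack : List ℕ) :
    enterTunnel (tunnel L 𝓑) b stack =
      open Classical in
      if NextIn (middle L 𝓑) (crossedL L 𝓑) (lastOutside (crossedL L 𝓑) p) then
        some (tunnelOffset L 𝓑 (crossedL L 𝓑) p :: stack)
      else some stack := by
  classical
  have h1 := lastOutside_spec (pos_of_mem_crossedL h𝓑) p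
  obtain ⟨a, ha⟩ := (exists_origin_eq_iff h𝓑 hC).2
    (fun h => h1.2.1 (middle_subset_crossedL h𝓑 h))
  have hval := val_eq_add_tunnelOffset h𝓑 hC (middle_subset_crossedL h𝓑)
    (pos_of_mem_crossedL h𝓑) ha hb
  have hiff : ((tunnel L 𝓑).cntL b = false ∨ bitAt (tunnel L 𝓑).cntL (b + 1) = false) ↔
      NextIn (middle L 𝓑) (crossedL L 𝓑) (lastOutside (crossedL L 𝓑) p) := by
    rw [← mem_or_nextIn_iff h𝓑, bitAt_succ_eq_false_iff h𝓑 hC tunnel_cntL_apply,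
      ← Bool.not_eq_true, tunnel_cntL_apply, not_not, hb]
  rw [enterTunnel, uppermost_eq_some h𝓑 ha hb]
  by_cases h : NextIn (middle L 𝓑) (crossedL L 𝓑) (lastOutside (crossedL L 𝓑) p)
  · rw [if_pos h, if_pos (hiff.2 h)]
    simp [hval]
  · rw [if_neg h, if_neg (fun h' => h (hiff.1 h'))]

include h𝓑 hC in
theorem leaveTunnel_eq_some {p : Fin n} {a b : Fin (tunnel L 𝓑).size}
    (ha : origin L 𝓑 a = lastOutside (crossedF L 𝓑) p)
    (hb : origin L 𝓑 b = lastOutside (middle L 𝓑) p) (stack : List ℕ) :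
    leaveTunnel (tunnel L 𝓑) a
        (open Classical in
        if NextIn (middle L 𝓑) (crossedF L 𝓑) (lastOutside (crossedF L 𝓑) p) then
          tunnelOffset L 𝓑 (crossedF L 𝓑) p :: stack
        else stack) = some (b, stack) := by
  classical
  have h1 := lastOutside_spec (pos_of_mem_crossedF h𝓑) p
  have h2 := lastOutside_spec (pos_of_mem_middle h𝓑) p
  have hval := val_eq_add_tunnelOffset h𝓑 hC (middle_subset_crossedF h𝓑)
    (pos_of_mem_crossedF h𝓑) ha hb
  have hiff := bitAt_succ_eq_false_iff h𝓑 hC (tunnel_cntF_apply (L := L) (𝓑 := 𝓑)) a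
  rw [ha] at hiff
  rw [leaveTunnel.eq_def]
  by_cases h : NextIn (middle L 𝓑) (crossedF L 𝓑) (lastOutside (crossedF L 𝓑) p)
  · rw [if_pos h, if_pos (hiff.2 h)]
    simp only
    rw [dif_pos (by rw [← hval]; exact b.isLt)]
    simp [← hval]
  · rw [if_neg h, if_neg (fun h' => h (hiff.1 h'))]
    -- If `a` and `b` differed, the first remaining position after `a` would be crossed out in F,
    -- and a tunnel would end here.
    have hab : a = b := by
      rcases (lastOutside_mono (middle_subset_crossedF h𝓑) (pos_of_mem_crossedF h𝓑) p).eq_or_lt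
        with heq | hlt
      · exact (origin L 𝓑).injective (by rw [ha, hb, heq])
      · obtain ⟨r, h3, h4, h5, h6⟩ := exists_next hlt h2.2.1
        exact (h ⟨r, h3, h5, h1.2.2 _ ⟨h3, h4.trans h2.1⟩, h6⟩).elim
    rw [hab]

end

/-! ### Reconstruction of the text -/

theorem IsBlock.iterate_mem_column {L : Fin n → Γ} {B : Block n} (hB : IsBlock L B) {x y : ℕ}
    (hxy : y + x ≤ B.d) {p : Fin n} (hp : p ∈ column L B x) :
    (lfMapping L)^[y] p ∈ column L B (y + x) := by
  obtain ⟨k, hk, rfl, -⟩ := hB.exists_row (by omega) hp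
  rw [← Function.iterate_add_apply]
  exact hB.mem_column hxy hk

section

variable [OrderBot Γ] {S : Fin n → Γ} (hS : NullTerminated S) {𝓑 : Set (Block n)}
  (h𝓑 : ∀ B ∈ 𝓑, IsBlock (bwt S) B) (hC : NoCriticalCollisions (bwt S) 𝓑)

/-- The position that is reached after `t` steps of the walk through the transform. -/
def walkPos (hS : NullTerminated S) (t : ℕ) : Fin n :=
  (lfMapping (bwt S))^[t] ⟨0, hS.pos⟩

theorem walkPos_add (s t : ℕ) :
    walkPos hS (s + t) = (lfMapping (bwt S))^[s] (walkPos hS t) :=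
  Function.iterate_add_apply _ _ _ _

/-- The walk through the transform never enters a block from the side. -/
theorem exists_add_eq_of_walkPos_mem {B : Block n} (hB : IsBlock (bwt S) B) (hij : B.i < B.j)
    {t : ℕ} (ht : walkPos hS t ∈ column (bwt S) B B.d) :
    ∃ s, B.d + s = t ∧ walkPos hS s ∈ column (bwt S) B 0 := by
  obtain ⟨k, hk, hkt, -⟩ := hB.exists_row le_rfl ht
  have hinj : ∀ m, Function.Injective ((lfMapping (bwt S))^[m]) :=
    fun m => (lfMapping_injective _).iterate m
  rcases le_or_gt B.d t with h | h
  · obtain ⟨s, rfl⟩ := Nat.exists_eq_add_of_le h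
    refine ⟨s, rfl, ?_⟩
    rw [walkPos_add] at hkt
    rw [hinj _ hkt]
    exact hB.mem_column (Nat.zero_le _) hk
  -- The walk would have begun inside the block: the row reaches position 0 right after column `m`,
  -- so that column carries `⊥`. As `⊥` occurs once, the block would have height 1.
  · exfalso
    obtain ⟨m, hm⟩ := Nat.exists_eq_add_of_lt h
    have h1 : (lfMapping (bwt S))^[B.d] k =
        (lfMapping (bwt S))^[t] (lfMapping (bwt S) ((lfMapping (bwt S))^[m] k)) := by
      rw [← Function.iterate_succ_apply' (lfMapping (bwt S)), ← Function.iterate_add_apply]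
      congr 2
    rw [h1] at hkt
    have h2 := (lfMapping_eq_zero_iff hS).1 (congrArg Fin.val (hinj _ hkt).symm)
    have h3 := hB.2 m (by omega) k hk
    have h4 := hB.2 m (by omega) B.j ⟨hB.1, le_rfl⟩
    rw [h2] at h3
    rw [← h3] at h4
    exact hij.ne (hinj _ (bwt_injective_at_bot hS h3.symm h4))

/-- `B` has a tunnel that starts at `p`. -/
def StartsAt (L : Fin n → Γ) (𝓑 : Set (Block n)) (p : Fin n) (B : Block n) : Prop :=
  B ∈ 𝓑 ∧ 0 < B.d ∧ B.i < B.j ∧ p ∈ column L B 0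

open Classical in
/-- The time at which the walk leaves the tunnel that it enters at time `s`; it is `s` if there
is none. -/
noncomputable def exitTime (hS : NullTerminated S) (𝓑 : Set (Block n)) (s : ℕ) : ℕ :=
  if h : ∃ B, StartsAt (bwt S) 𝓑 (walkPos hS s) B then h.choose.d + s else s

include h𝓑 hC in
-- The choice in `exitTime` is harmless: two different blocks cannot share a position of both their
-- first columns.
theorem exitTime_eq {B : Block n} {s : ℕ} (hB : StartsAt (bwt S) 𝓑 (walkPos hS s) B) :
    exitTime hS 𝓑 s = B.d + s := by
  have h : ∃ B, StartsAt (bwt S) 𝓑 (walkPos hS s) B := ⟨B, hB⟩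
  rw [exitTime, dif_pos h]
  rcases eq_or_compensableAs_of_mem_end h𝓑 hC hB.1 h.choose_spec.1 (Or.inl rfl) (Nat.zero_le _)
    hB.2.2.2 h.choose_spec.2.2.2 with h1 | h1
  · rw [h1.1]
  · exact absurd h1.2.1 (lt_irrefl _)

theorem exists_startsAt_of_lt_exitTime {s : ℕ} (h : s < exitTime hS 𝓑 s) :
    ∃ B, StartsAt (bwt S) 𝓑 (walkPos hS s) B := by
  by_contra hcon
  rw [exitTime, dif_neg hcon] at h
  exact lt_irrefl _ h

include h𝓑 hC in
-- The block entered at `s` passes through the first column of the one entered at `s'`, so it is the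
-- outer one. Were the inner block to last at least as long, it would share a position of the last
-- column of the outer block.
theorem exitTime_nested (s s' : ℕ) (hss' : s < s') (h : s' ≤ exitTime hS 𝓑 s)
    (h' : s' < exitTime hS 𝓑 s') : exitTime hS 𝓑 s' < exitTime hS 𝓑 s := by
  obtain ⟨B, hB⟩ := exists_startsAt_of_lt_exitTime hS (hss'.trans_le h)
  obtain ⟨B', hB'⟩ := exists_startsAt_of_lt_exitTime hS h'
  rw [exitTime_eq hS h𝓑 hC hB] at h ⊢
  rw [exitTime_eq hS h𝓑 hC hB']
  obtain ⟨m, rfl⟩ := Nat.exists_eq_add_of_lt hss'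
  have h1 : walkPos hS (s + m + 1) ∈ column (bwt S) B (m + 1) := by
    have := (h𝓑 B hB.1).iterate_mem_column (y := m + 1) (by omega) hB.2.2.2
    rwa [← walkPos_add, show m + 1 + s = s + m + 1 by omega] at this
  rcases eq_or_compensableAs_of_mem_end h𝓑 hC hB'.1 hB.1 (Or.inl rfl) (by omega)
    hB'.2.2.2 h1 with h2 | h2
  · omega
  · by_contra hle
    obtain ⟨r, hr⟩ : ∃ r, B.d = r + (m + 1) := ⟨B.d - (m + 1), by omega⟩
    have h3 := (h𝓑 B hB.1).iterate_mem_column (y := r) (by omega) h1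
    have h4 := (h𝓑 B' hB'.1).iterate_mem_column (y := r) (by omega) hB'.2.2.2
    rw [← hr] at h3
    exact h2.1.end_unshared _ h3 ⟨⟨r + 0, by omega, h4⟩, ⟨_, le_rfl, h3⟩⟩

include h𝓑 hC in
theorem nextIn_crossedL_iff (t : ℕ) :
    NextIn (middle (bwt S) 𝓑) (crossedL (bwt S) 𝓑)
        (lastOutside (crossedL (bwt S) 𝓑) (walkPos hS t)) ↔ t < exitTime hS 𝓑 t := by
  rw [(isCrossedAt_crossedL h𝓑).nextIn_iff h𝓑 hC]
  constructor
  · rintro ⟨B, hB⟩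
    rw [exitTime_eq hS h𝓑 hC (B := B) hB]
    have := hB.2.1
    omega
  · intro h
    exact exists_startsAt_of_lt_exitTime hS h

include h𝓑 hC in
theorem nextIn_crossedF_iff (t : ℕ) :
    NextIn (middle (bwt S) 𝓑) (crossedF (bwt S) 𝓑)
        (lastOutside (crossedF (bwt S) 𝓑) (walkPos hS t)) ↔
      ∃ s < t, exitTime hS 𝓑 s = t := by
  rw [(isCrossedAt_crossedF h𝓑).nextIn_iff h𝓑 hC]
  constructor
  · rintro ⟨B, hB, hd, hij, ht⟩
    obtain ⟨s, hs, hs'⟩ := exists_add_eq_of_walkPos_mem hS (h𝓑 B hB) hij ht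
    exact ⟨s, by omega, (exitTime_eq hS h𝓑 hC ⟨hB, hd, hij, hs'⟩).trans hs⟩
  · rintro ⟨s, hst, hs⟩
    obtain ⟨B, hB⟩ := exists_startsAt_of_lt_exitTime (𝓑 := 𝓑) (s := s) hS (by omega)
    rw [exitTime_eq hS h𝓑 hC hB] at hs
    refine ⟨B, hB.1, hB.2.1, hB.2.2.1, ?_⟩
    have := (h𝓑 B hB.1).iterate_mem_column (y := B.d) (by omega) hB.2.2.2
    rwa [← walkPos_add, hs] at this

include h𝓑 hC in
theorem tunnelOffset_exitTime {s t : ℕ} (hst : s < t) (hs : exitTime hS 𝓑 s = t) :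
    tunnelOffset (bwt S) 𝓑 (crossedL (bwt S) 𝓑) (walkPos hS s) =
      tunnelOffset (bwt S) 𝓑 (crossedF (bwt S) 𝓑) (walkPos hS t) := by
  obtain ⟨B, hB⟩ := exists_startsAt_of_lt_exitTime (𝓑 := 𝓑) (s := s) hS (by omega)
  rw [exitTime_eq hS h𝓑 hC hB] at hs
  rw [← tunnelOffset_crossedF_eq h𝓑 hC hB.1 hB.2.1 hB.2.2.2, ← walkPos_add, hs]

/-- The contents of the stack before step `t` of the walk. -/
noncomputable def stackAt (hS : NullTerminated S) (𝓑 : Set (Block n)) (t : ℕ) : List ℕ :=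
  ((List.range t).reverse.filter fun s => t ≤ exitTime hS 𝓑 s).map fun s =>
    tunnelOffset (bwt S) 𝓑 (crossedL (bwt S) 𝓑) (walkPos hS s)

/-- The contents of the stack after the tunnel that ends at step `t` has been left. -/
noncomputable def stackAfterLeave (hS : NullTerminated S) (𝓑 : Set (Block n)) (t : ℕ) :
    List ℕ :=
  ((List.range t).reverse.filter fun s => t < exitTime hS 𝓑 s).map fun s =>
    tunnelOffset (bwt S) 𝓑 (crossedL (bwt S) 𝓑) (walkPos hS s)

include h𝓑 hC in
-- The invariant of the walk. With `t` steps done and `m` to go, the stack holds the offsets of the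
-- tunnels entered before `t` and not yet left, newest first.
theorem reconstructLoop_eq_some (m : ℕ) : ∀ (t : ℕ) (a : Fin (tunnel (bwt S) 𝓑).size)
    (acc : List Γ), m + t + 1 = n →
    origin (bwt S) 𝓑 a = lastOutside (crossedF (bwt S) 𝓑) (walkPos hS t) →
    reconstructLoop (tunnel (bwt S) 𝓑) m a (stackAt hS 𝓑 t) acc =
      some ((List.ofFn S).take m ++ acc) := by
  classical
  induction m with
  | zero => intro t a acc _ _; simp [reconstructLoop]
  | succ m ih =>
    intro t a acc hmt ha
    set p := walkPos hS t with hp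
    obtain ⟨b, hb⟩ := (exists_origin_eq_iff h𝓑 hC).2 (lastOutside_spec (pos_of_mem_middle h𝓑) p).2.1
    -- By nestedness the tunnel that ends at `t`, if any, is on top, and its entry offset equals the
    -- one required at its end.
    have hleave : stackAt hS 𝓑 t =
        if NextIn (middle (bwt S) 𝓑) (crossedF (bwt S) 𝓑)
            (lastOutside (crossedF (bwt S) 𝓑) p) then
          tunnelOffset (bwt S) 𝓑 (crossedF (bwt S) 𝓑) p :: stackAfterLeave hS 𝓑 t
        else stackAfterLeave hS 𝓑 t := by
      simp only [hp, nextIn_crossedF_iff hS h𝓑 hC]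
      split_ifs with h
      · obtain ⟨s, hst, hs⟩ := h
        rw [stackAt, filter_range_of_eq (exitTime_nested hS h𝓑 hC) hst hs, List.map_cons,
          tunnelOffset_exitTime hS h𝓑 hC hst hs, stackAfterLeave]
      · push Not at h
        rw [stackAt, filter_range_of_forall_ne h, stackAfterLeave]
    have henter : stackAt hS 𝓑 (t + 1) =
        if NextIn (middle (bwt S) 𝓑) (crossedL (bwt S) 𝓑)
            (lastOutside (crossedL (bwt S) 𝓑) p) then
          tunnelOffset (bwt S) 𝓑 (crossedL (bwt S) 𝓑) p :: stackAfterLeave hS 𝓑 t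
        else stackAfterLeave hS 𝓑 t := by
      simp only [hp, nextIn_crossedL_iff hS h𝓑 hC]
      rw [stackAt, filter_range_succ]
      split_ifs with h
      · rw [List.map_cons, stackAfterLeave]
      · rw [stackAfterLeave]
    have h1 := lastOutside_spec (pos_of_mem_crossedL h𝓑) p
    obtain ⟨a', ha'⟩ := (exists_origin_eq_iff h𝓑 hC
        (q := lfMapping (bwt S) (lastOutside (crossedL (bwt S) 𝓑) p))).2 fun h => by
      have := middle_subset_crossedF h𝓑 h
      rw [lfMapping_mem_crossedF_iff] at this
      exact h1.2.1 this
    have hL : (tunnel (bwt S) 𝓑).L b = S ⟨m, by omega⟩ := by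
      rw [tunnel_L_apply, hb, apply_lastOutside_middle h𝓑, hp, walkPos, bwt_iterate hS t (by omega)]
      congr 1
      apply Fin.ext
      simp only
      omega
    rw [reconstructLoop, hleave, leaveTunnel_eq_some h𝓑 hC ha hb]
    simp only [Option.bind_some]
    rw [enterTunnel_eq_some h𝓑 hC hb, ← apply_ite some, ← henter]
    simp only [Option.bind_some]
    rw [generalizedLF_eq_some h𝓑 hC ha' hb]
    simp only [Option.bind_some]
    rw [ih (t + 1) a' _ (by omega)]
    · rw [hL, List.take_succ_eq_append_getElem (by simp; omega), List.append_assoc]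
      simp
    · rw [ha', ← lastOutside_crossedF_lfMapping h𝓑, hp, walkPos, walkPos,
        Function.iterate_succ_apply']

include hS h𝓑 hC in
theorem reconstruct_tunnel :
    reconstruct (tunnel (bwt S) 𝓑) n = some (List.ofFn S) := by
  have hn := hS.pos
  obtain ⟨a, ha⟩ := (exists_origin_eq_iff h𝓑 hC (q := ⟨0, hn⟩)).2
    fun h => by simpa using pos_of_mem_middle h𝓑 _ h
  have ha0 : a.val = 0 := by
    by_contra hne
    have : (⟨0, by have := a.isLt; omega⟩ : Fin (tunnel (bwt S) 𝓑).size) < a := by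
      rw [Fin.lt_def]; simp only; omega
    rw [← (origin (bwt S) 𝓑).lt_iff_lt, ha, Fin.lt_def] at this
    simp at this
  have hpos : 0 < (tunnel (bwt S) 𝓑).size := by have := a.isLt; omega
  have h := reconstructLoop_eq_some hS h𝓑 hC (n - 1) 0 a [⊥] (by omega) (by
    rw [ha, walkPos, Function.iterate_zero, id]
    refine (lastOutside_eq (pos_of_mem_crossedF h𝓑) le_rfl
      (fun h => by simpa using pos_of_mem_crossedF h𝓑 _ h) fun r hr => ?_).symm
    exact absurd hr.1 (not_lt.2 hr.2))
  rw [reconstruct, dif_pos hpos]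
  have ha' : (⟨0, hpos⟩ : Fin (tunnel (bwt S) 𝓑).size) = a := Fin.ext ha0.symm
  rw [ha']
  have hst : stackAt hS 𝓑 0 = [] := by simp [stackAt]
  rw [hst] at h
  rw [h]
  congr 1
  have hbot : S ⟨n - 1, by omega⟩ = ⊥ := (hS.2 _).2 (by simp only; omega)
  have := List.take_succ_eq_append_getElem (i := n - 1) (l := List.ofFn S) (by simp; omega)
  rw [List.getElem_ofFn, hbot] at this
  rw [← this]
  apply List.take_of_length_le
  simp; omega

end

end

/-! ### Execution of machine programs -/

/-- Per iteration, 7 is the test (3) plus the increment (4); the final 5 is the initial assignment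
(2) plus the failing test (3). The invariant refers to the state in which the counter is already
set. -/
theorem exec_forUpTo {r bound : Reg} (hr : r ≠ bound) {P : Prog} {c N : ℕ}
    (Inv : ℕ → State → Prop)
    (hbody : ∀ v < N, ∀ s : State, Inv v s → s.reg r = v → s.reg bound = N →
      ∃ t s', Exec P s t s' ∧ t ≤ c ∧ s'.reg r = v ∧ s'.reg bound = N ∧
        Inv (v + 1) (s'.setReg r (v + 1)))
    (s : State) (hs : s.reg bound = N) (h0 : Inv 0 (s.setReg r 0)) :
    ∃ t s', Exec (.forUpTo r bound P) s t s' ∧ t ≤ N * (c + 7) + 5 ∧ Inv N s' := by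
  have hloop : ∀ m v, v + m = N → ∀ s : State, Inv v s → s.reg r = v → s.reg bound = N →
      ∃ t s', Exec (.while (.lt (.reg r) (.reg bound))
        (.seq P (.assign r (.add (.reg r) (.lit 1))))) s t s' ∧ t ≤ m * (c + 7) + 3 ∧
          Inv N s' := by
    intro m
    induction m with
    | zero =>
      intro v hv s hI h1 h2
      refine ⟨_, s, Exec.while_false ?_, ?_, ?_⟩
      · simp only [Test.eval, Expr.eval, h1, h2, decide_eq_false_iff_not]; omega
      · simp [Test.cost, Expr.cost]
      · rwa [← hv]
    | succ m ih =>
      intro v hv s hI h1 h2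
      obtain ⟨t, s', hex, ht, h3, h4, h5⟩ := hbody v (by omega) s hI h1 h2
      obtain ⟨t', s'', hex', ht', h6⟩ := ih (v + 1) (by omega) (s'.setReg r (v + 1)) h5
        (by simp [State.setReg]) (by simp [State.setReg, Function.update_of_ne hr.symm, h4])
      have hinc : Exec (.assign r (.add (.reg r) (.lit 1))) s' 4 (s'.setReg r (v + 1)) := by
        have := Exec.assign r (.add (.reg r) (.lit 1)) s'
        simpa [Expr.cost, Expr.eval, h3] using this
      refine ⟨_, s'', Exec.while_true ?_ (Exec.seq hex hinc) hex', ?_, h6⟩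
      · simp only [Test.eval, Expr.eval, h1, h2, decide_eq_true_eq]; omega
      · simp only [Test.cost, Expr.cost]
        have : (m + 1) * (c + 7) = m * (c + 7) + (c + 7) := by ring
        omega
  obtain ⟨t, s', hex, ht, hI⟩ := hloop N 0 (by omega) (s.setReg r 0) h0
    (by simp [State.setReg]) (by simp [State.setReg, Function.update_of_ne hr.symm, hs])
  refine ⟨_, s', Exec.seq (Exec.assign r (.lit 0) s) hex, ?_, hI⟩
  simp only [Expr.cost]
  omega

/-- The input in the state `s` is that of `s₀`. -/
structure HasInput (s₀ s : State) : Prop where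
  size : s.reg .size = s₀.reg .size
  textLen : s.reg .textLen = s₀.reg .textLen
  alphabetSize : s.reg .alphabetSize = s₀.reg .alphabetSize
  dollar : s.reg .dollar = s₀.reg .dollar
  L : s.arr .L = s₀.arr .L
  cntL : s.arr .cntL = s₀.arr .cntL
  cntF : s.arr .cntF = s₀.arr .cntF

theorem HasInput.refl (s : State) : HasInput s s := ⟨rfl, rfl, rfl, rfl, rfl, rfl, rfl⟩

theorem HasInput.setReg {s₀ s : State} (h : HasInput s₀ s) {r : Reg} (v : ℕ)
    (hr : r ∉ [Reg.size, .textLen, .alphabetSize, .dollar]) : HasInput s₀ (s.setReg r v) := by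
  simp only [List.mem_cons, List.not_mem_nil, or_false, not_or] at hr
  obtain ⟨h1, h2, h3, h4⟩ := hr
  refine ⟨?_, ?_, ?_, ?_, h.L, h.cntL, h.cntF⟩ <;>
    simp [State.setReg, h.size, h.textLen, h.alphabetSize, h.dollar,
      Ne.symm h1, Ne.symm h2, Ne.symm h3, Ne.symm h4]

theorem HasInput.setArr {s₀ s : State} (h : HasInput s₀ s) {a : Arr} (i v : ℕ)
    (ha : a ∉ [Arr.L, .cntL, .cntF]) : HasInput s₀ (s.setArr a i v) := by
  simp only [List.mem_cons, List.not_mem_nil, or_false, not_or] at ha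
  obtain ⟨h1, h2, h3⟩ := ha
  refine ⟨h.size, h.textLen, h.alphabetSize, h.dollar, ?_, ?_, ?_⟩ <;>
    simp [State.setArr, h.L, h.cntL, h.cntF,
      Ne.symm h1, Ne.symm h2, Ne.symm h3]

theorem HasInput.congr {s₀ s s' : State} (h : HasInput s₀ s)
    (hr : ∀ r ∈ [Reg.size, .textLen, .alphabetSize, .dollar], s'.reg r = s.reg r)
    (ha : ∀ a ∈ [Arr.L, .cntL, .cntF], s'.arr a = s.arr a) : HasInput s₀ s' :=
  ⟨(hr _ (by simp)).trans h.size, (hr _ (by simp)).trans h.textLen,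
    (hr _ (by simp)).trans h.alphabetSize, (hr _ (by simp)).trans h.dollar,
    (ha _ (by simp)).trans h.L, (ha _ (by simp)).trans h.cntL, (ha _ (by simp)).trans h.cntF⟩

theorem State.setReg_reg (s : State) (r r' : Reg) (v : ℕ) :
    (s.setReg r v).reg r' = if r' = r then v else s.reg r' := by
  simp [State.setReg, Function.update_apply]

theorem State.setReg_arr (s : State) (r : Reg) (v : ℕ) : (s.setReg r v).arr = s.arr := rfl

theorem State.setArr_reg (s : State) (a : Arr) (i v : ℕ) : (s.setArr a i v).reg = s.reg := rfl

theorem State.setArr_arr (s : State) (a a' : Arr) (i v : ℕ) :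
    (s.setArr a i v).arr a' = if a' = a then Function.update (s.arr a') i v else s.arr a' := by
  by_cases h : a' = a
  · subst h; simp [State.setArr]
  · simp [State.setArr, h]

/-! ### Counting -/

theorem card_filter_lt_succ {N : ℕ} (P : Fin N → Prop) [DecidablePred P] {v : ℕ} (hv : v < N) :
    (Finset.univ.filter fun q : Fin N => q.val < v + 1 ∧ P q).card =
      (Finset.univ.filter fun q : Fin N => q.val < v ∧ P q).card +
        if P ⟨v, hv⟩ then 1 else 0 := by
  have h : (Finset.univ.filter fun q : Fin N => q.val < v + 1 ∧ P q) =
      (Finset.univ.filter fun q : Fin N => q.val < v ∧ P q) ∪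
        (Finset.univ.filter fun q : Fin N => q = ⟨v, hv⟩ ∧ P q) := by
    ext q
    simp only [Finset.mem_filter, Finset.mem_univ, true_and, Finset.mem_union, Fin.ext_iff,
      ← or_and_right]
    exact and_congr_left fun _ => by omega
  rw [h, Finset.card_union_of_disjoint]
  · congr 1
    split_ifs with hP
    · rw [Finset.card_eq_one]
      refine ⟨⟨v, hv⟩, ?_⟩
      ext q
      simp only [Finset.mem_filter, Finset.mem_univ, true_and, Finset.mem_singleton]
      exact ⟨fun h => h.1, fun h => ⟨h, h ▸ hP⟩⟩
    · rw [Finset.card_eq_zero, Finset.filter_eq_empty_iff]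
      rintro q - ⟨rfl, hq⟩
      exact hP hq
  · rw [Finset.disjoint_left]
    intro q hq hq'
    simp only [Finset.mem_filter, Finset.mem_univ, true_and] at hq hq'
    have := congrArg Fin.val hq'.1
    simp only at this
    omega

theorem card_filter_value_lt_succ {N : ℕ} (P : Fin N → Prop) [DecidablePred P] (f : Fin N → ℕ)
    (v : ℕ) :
    (Finset.univ.filter fun q : Fin N => P q ∧ f q < v + 1).card =
      (Finset.univ.filter fun q : Fin N => P q ∧ f q < v).card +
        (Finset.univ.filter fun q : Fin N => P q ∧ f q = v).card := by
  rw [← Finset.card_union_of_disjoint, ← Finset.filter_or]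
  · congr 1
    ext q
    simp only [Finset.mem_filter, Finset.mem_univ, true_and, ← and_or_left]
    exact and_congr_right fun _ => by omega
  · rw [Finset.disjoint_left]
    intro q hq hq'
    simp only [Finset.mem_filter, Finset.mem_univ, true_and] at hq hq'
    omega

theorem find?_pairwise_spec {α : Type*} {R : α → α → Prop} {l : List α} {P : α → Bool}
    {a : α} (hl : l.Pairwise R) (h : l.find? P = some a) :
    P a = true ∧ ∀ x ∈ l, P x = true → x = a ∨ R a x := by
  rw [List.find?_eq_some_iff_append] at h
  obtain ⟨ha, l₁, l₂, rfl, h⟩ := h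
  refine ⟨ha, fun x hx hPx => ?_⟩
  rw [List.pairwise_append, List.pairwise_cons] at hl
  rw [List.mem_append, List.mem_cons] at hx
  rcases hx with hx | rfl | hx
  · have := h x hx
    simp [hPx] at this
  · exact Or.inl rfl
  · exact Or.inr (hl.2.1.1 x hx)

/-! ### What successful partial operations and the initial state provide -/

section

variable {Γ : Type u} [LinearOrder Γ] {T : TunneledBWT Γ}

omit [LinearOrder Γ] in
theorem uppermost_spec {j l : Fin T.size} (h : uppermost T j = some l) :
    l ≤ j ∧ T.cntL l = true ∧ ∀ x, l < x → x ≤ j → T.cntL x = false := by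
  obtain ⟨h1, h2⟩ := find?_pairwise_spec (R := fun x y => y < x)
    (List.pairwise_reverse.2 (List.pairwise_lt_finRange _)) h
  simp only [Bool.and_eq_true, decide_eq_true_eq] at h1 h2
  refine ⟨h1.1, h1.2, fun x hlx hxj => ?_⟩
  rw [← Bool.not_eq_true]
  intro hx
  rcases h2 x (by simp) ⟨hxj, hx⟩ with rfl | h3
  · exact lt_irrefl _ hlx
  · exact lt_asymm hlx h3

theorem generalizedLF_spec {p v : Fin T.size} (h : generalizedLF T p = some v) :
    T.cntF v = true ∧ (Finset.univ.filter fun q => q ≤ v ∧ T.cntF q = true).card =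
      (Finset.univ.filter fun q => T.cntL q = true ∧ T.L q < T.L p).card +
      (Finset.univ.filter fun q => q ≤ p ∧ T.cntL q = true ∧ T.L q = T.L p).card := by
  have := List.find?_some h
  simpa using this

variable [OrderBot Γ] {len : ℕ} {code : Γ → ℕ} {σ : ℕ}

theorem initState_L {v : ℕ} (hv : v < T.size) :
    (initState T len code σ).arr .L v = code (T.L ⟨v, hv⟩) := by
  simp [initState, hv]

theorem initState_cntL {v : ℕ} (hv : v < T.size) :
    (initState T len code σ).arr .cntL v = (T.cntL ⟨v, hv⟩).toNat := by
  simp [initState, bitAt, hv, hv.le]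

theorem initState_cntF {v : ℕ} (hv : v < T.size) :
    (initState T len code σ).arr .cntF v = (T.cntF ⟨v, hv⟩).toNat := by
  simp [initState, bitAt, hv, hv.le]

theorem initState_cntL_succ {v : ℕ} (hv : v < T.size) :
    (initState T len code σ).arr .cntL (v + 1) = (bitAt T.cntL (v + 1)).toNat := by
  simp [initState, Nat.succ_le_of_lt hv]

theorem initState_cntF_succ {v : ℕ} (hv : v < T.size) :
    (initState T len code σ).arr .cntF (v + 1) = (bitAt T.cntF (v + 1)).toNat := by
  simp [initState, Nat.succ_le_of_lt hv]

/-! ### The precomputed tables -/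

theorem exec_countChars {s : State} (hs : HasInput (initState T len code σ) s)
    (hC : ∀ c, s.arr .C c = 0) :
    ∃ t s', Exec countChars s t s' ∧ t ≤ T.size * 16 + 5 ∧
      HasInput (initState T len code σ) s' ∧
      ∀ c, s'.arr .C c =
        (Finset.univ.filter fun q => T.cntL q = true ∧ code (T.L q) = c).card := by
  have hfor := exec_forUpTo (r := .i) (bound := .size) (by simp)
    (P := .store .C (.get .L (.reg .i))
      (.add (.get .C (.get .L (.reg .i))) (.get .cntL (.reg .i)))) (c := 9) (N := T.size)
    (fun v s => HasInput (initState T len code σ) s ∧ ∀ c, s.arr .C c =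
      (Finset.univ.filter fun q : Fin T.size =>
        q.val < v ∧ (T.cntL q = true ∧ code (T.L q) = c)).card) ?_ s hs.size
    ⟨hs.setReg _ (by simp), by simp [State.setReg_arr, hC]⟩
  · obtain ⟨t, s', h1, h2, h3, h4⟩ := hfor
    refine ⟨t, s', h1, h2, h3, fun c => ?_⟩
    rw [h4]
    simp only [Fin.is_lt, true_and]
  · intro v hv s hI hi hsize
    refine ⟨_, _, Exec.store _ _ _ _, by simp [Expr.cost], hi, hsize,
      (hI.1.setArr _ _ (by simp)).setReg _ (by simp), fun c => ?_⟩
    rw [card_filter_lt_succ _ hv]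
    simp only [Expr.eval, hi, State.setReg_arr, State.setArr_arr, hI.1.L, hI.1.cntL, if_true,
      initState_L hv, initState_cntL hv, Function.update_apply, hI.2]
    by_cases hc : c = code (T.L ⟨v, hv⟩)
    · subst hc
      cases h : T.cntL ⟨v, hv⟩ <;> simp
    · simp [hc, Ne.symm hc]

/-- The array is overwritten in place: below the counter it holds prefix sums, from the counter on
still plain counts. -/
theorem exec_prefixSums {s : State} (hs : HasInput (initState T len code σ) s)
    (hC : ∀ c, s.arr .C c =
      (Finset.univ.filter fun q => T.cntL q = true ∧ code (T.L q) = c).card) :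
    ∃ t s', Exec prefixSums s t s' ∧ t ≤ σ * 17 + 7 ∧
      HasInput (initState T len code σ) s' ∧
      ∀ c < σ, s'.arr .C c =
        (Finset.univ.filter fun q => T.cntL q = true ∧ code (T.L q) < c).card := by
  have hfor := exec_forUpTo (r := .c) (bound := .alphabetSize) (by simp)
    (P := .seq (.assign .k (.get .C (.reg .c))) (.seq (.store .C (.reg .c) (.reg .sum))
      (.assign .sum (.add (.reg .sum) (.reg .k))))) (c := 10) (N := σ)
    (fun v s => HasInput (initState T len code σ) s ∧
      s.reg .sum = (Finset.univ.filter fun q => T.cntL q = true ∧ code (T.L q) < v).card ∧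
      (∀ c < v, s.arr .C c =
        (Finset.univ.filter fun q => T.cntL q = true ∧ code (T.L q) < c).card) ∧
      ∀ c, v ≤ c → s.arr .C c =
        (Finset.univ.filter fun q => T.cntL q = true ∧ code (T.L q) = c).card) ?_
    (s.setReg .sum 0) (by rw [State.setReg_reg]; exact hs.alphabetSize)
    ⟨(hs.setReg _ (by simp)).setReg _ (by simp), by simp [State.setReg_reg], by simp,
      by simpa [State.setReg_arr] using hC⟩
  · obtain ⟨t, s', h1, h2, h3, -, h4, -⟩ := hfor
    refine ⟨_, s', Exec.seq (Exec.assign .sum (.lit 0) s) h1, ?_, h3, h4⟩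
    simp only [Expr.cost]
    omega
  · rintro v hv s ⟨hI, hsum, hlt, hge⟩ hc halph
    refine ⟨_, _, Exec.seq (Exec.assign _ _ _) (Exec.seq (Exec.store _ _ _ _)
      (Exec.assign _ _ _)), by simp [Expr.cost], ?_, ?_, ?_, ?_, fun c hcv => ?_, fun c hcv => ?_⟩
    · simp [State.setReg_reg, State.setArr_reg, hc]
    · simp [State.setReg_reg, State.setArr_reg, halph]
    · exact (((hI.setReg _ (by simp)).setArr _ _ (by simp)).setReg _ (by simp)).setReg _ (by simp)
    · rw [card_filter_value_lt_succ]
      simp [State.setReg_reg, State.setArr_reg, Expr.eval, hc, hsum, hge v le_rfl]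
    · simp only [State.setReg_reg, State.setReg_arr, State.setArr_arr, Expr.eval, hc, hsum]
      by_cases h : c = v
      · subst h; simp
      · simp [h, hlt c (by omega)]
    · simp only [State.setReg_reg, State.setReg_arr, State.setArr_arr, Expr.eval, hc, hsum]
      simp [show c ≠ v by omega, hge c (by omega)]

theorem exec_selectTable {s : State} (hs : HasInput (initState T len code σ) s) :
    ∃ t s', Exec selectTable s t s' ∧ t ≤ T.size * 18 + 7 ∧
      HasInput (initState T len code σ) s' ∧ s'.arr .C = s.arr .C ∧
      ∀ q, T.cntF q = true → s'.arr .sel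
        ((Finset.univ.filter fun q' => q' ≤ q ∧ T.cntF q' = true).card - 1) = q := by
  have hfor := exec_forUpTo (r := .i) (bound := .size) (by simp)
    (P := .ite (.eq (.get .cntF (.reg .i)) (.lit 1))
      (.seq (.store .sel (.reg .k) (.reg .i)) (.assign .k (.add (.reg .k) (.lit 1))))
      .skip) (c := 11) (N := T.size)
    (fun v s' => HasInput (initState T len code σ) s' ∧ s'.arr .C = s.arr .C ∧
      s'.reg .k = (Finset.univ.filter fun q' : Fin T.size =>
        q'.val < v ∧ T.cntF q' = true).card ∧
      ∀ q, T.cntF q = true → q.val < v → s'.arr .sel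
        (Finset.univ.filter fun q' : Fin T.size => q'.val < q ∧ T.cntF q' = true).card = q) ?_
    (s.setReg .k 0) (by rw [State.setReg_reg]; exact hs.size)
    ⟨(hs.setReg _ (by simp)).setReg _ (by simp), rfl, by simp [State.setReg_reg], by simp⟩
  · obtain ⟨t, s', h1, h2, h3, h4, -, h5⟩ := hfor
    refine ⟨_, s', Exec.seq (Exec.assign .k (.lit 0) s) h1, ?_, h3, h4, fun q hq => ?_⟩
    · simp only [Expr.cost]; omega
    · have h6 := card_filter_lt_succ (fun q' => T.cntF q' = true) q.isLt
      simp only [hq, if_true, Nat.lt_succ_iff] at h6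
      rw [show (Finset.univ.filter fun q' => q' ≤ q ∧ T.cntF q' = true).card =
        (Finset.univ.filter fun q' : Fin T.size => q'.val < q ∧ T.cntF q' = true).card + 1
        from h6, Nat.add_sub_cancel]
      exact h5 q hq q.isLt
  · rintro v hv s' ⟨hI, hCs, hk, hsel⟩ hi hsize
    have hcnt := card_filter_lt_succ (fun q' => T.cntF q' = true) hv
    cases hb : T.cntF ⟨v, hv⟩ with
    | true =>
      simp only [hb, if_true] at hcnt
      refine ⟨_, _, Exec.ite_true ?_ (Exec.seq (Exec.store _ _ _ _) (Exec.assign _ _ _)),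
        by simp [Expr.cost, Test.cost], ?_, ?_, ?_, ?_, ?_, ?_⟩
      · simp [Test.eval, Expr.eval, hi, hI.cntF, initState_cntF hv, hb]
      · simp [State.setReg_reg, State.setArr_reg, hi]
      · simp [State.setReg_reg, State.setArr_reg, hsize]
      · exact ((hI.setArr _ _ (by simp)).setReg _ (by simp)).setReg _ (by simp)
      · simp [State.setReg_arr, State.setArr_arr, hCs]
      · rw [hcnt]
        simp [State.setReg_reg, State.setArr_reg, Expr.eval, hk]
      · intro q hq hqv
        simp only [State.setReg_arr, State.setArr_arr, Expr.eval, hi, hk, if_true,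
          Function.update_apply]
        by_cases h : q.val = v
        · simp [h]
        -- An earlier one has fewer ones before it, so its cell is not the one being written.
        · rw [if_neg, hsel q hq (by omega)]
          refine (Finset.card_lt_card ?_).ne
          rw [Finset.ssubset_iff_of_subset]
          · refine ⟨q, ?_, by simp⟩
            simp only [Finset.mem_filter, Finset.mem_univ, true_and]
            exact ⟨by omega, hq⟩
          · intro x hx
            simp only [Finset.mem_filter, Finset.mem_univ, true_and] at hx ⊢
            exact ⟨by omega, hx.2⟩
    | false =>
      simp only [hb, Bool.false_eq_true, if_false] at hcnt
      refine ⟨_, _, Exec.ite_false ?_ (Exec.skip _),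
        by simp [Expr.cost, Test.cost], hi, hsize, ?_, ?_, ?_, ?_⟩
      · simp [Test.eval, Expr.eval, hi, hI.cntF, initState_cntF hv, hb]
      · exact hI.setReg _ (by simp)
      · simp [State.setReg_arr, hCs]
      · rw [hcnt]
        simp [State.setReg_reg, hk]
      · intro q hq hqv
        have : q.val ≠ v := by
          rintro rfl
          rw [hq] at hb
          exact Bool.false_ne_true hb.symm
        exact hsel q hq (by omega)

/-- The array `C` serves as running counters. Once the current position is counted, the cell of its
character holds the argument of select in `generalizedLF`; the table `sel` is indexed from 0, hence
the subtraction of 1. -/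
theorem exec_lfTable {s : State} (hs : HasInput (initState T len code σ) s)
    (hσ : ∀ q, code (T.L q) < σ) (hcode : ∀ q q', code (T.L q) < code (T.L q') ↔ T.L q < T.L q')
    (hC : ∀ c < σ, s.arr .C c =
      (Finset.univ.filter fun q => T.cntL q = true ∧ code (T.L q) < c).card)
    (hsel : ∀ q, T.cntF q = true → s.arr .sel
      ((Finset.univ.filter fun q' => q' ≤ q ∧ T.cntF q' = true).card - 1) = q) :
    ∃ t s', Exec lfTable s t s' ∧ t ≤ T.size * 25 + 5 ∧
      HasInput (initState T len code σ) s' ∧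
      ∀ q q', generalizedLF T q = some q' → s'.arr .LF q = q' := by
  have hcode' : ∀ q q', code (T.L q) = code (T.L q') ↔ T.L q = T.L q' := by
    intro q q'
    have h1 := hcode q q'
    have h2 := hcode q' q
    refine ⟨fun h => le_antisymm (not_lt.1 ?_) (not_lt.1 ?_), fun h => by rw [h]⟩
    · rw [← h2]; omega
    · rw [← h1]; omega
  have hfor := exec_forUpTo (r := .i) (bound := .size) (by simp)
    (P := .seq (.store .C (.get .L (.reg .i))
      (.add (.get .C (.get .L (.reg .i))) (.get .cntL (.reg .i))))
     (.store .LF (.reg .i)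
      (.get .sel (.sub (.get .C (.get .L (.reg .i))) (.lit 1))))) (c := 18) (N := T.size)
    (fun v s' => HasInput (initState T len code σ) s' ∧ s'.arr .sel = s.arr .sel ∧
      (∀ c < σ, s'.arr .C c =
        (Finset.univ.filter fun q => T.cntL q = true ∧ code (T.L q) < c).card +
        (Finset.univ.filter fun q : Fin T.size =>
          q.val < v ∧ T.cntL q = true ∧ code (T.L q) = c).card) ∧
      ∀ q q', q.val < v → generalizedLF T q = some q' → s'.arr .LF q = q') ?_
    s hs.size ⟨hs.setReg _ (by simp), rfl, by simpa [State.setReg_arr] using hC, by simp⟩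
  · obtain ⟨t, s', h1, h2, h3, -, -, h4⟩ := hfor
    exact ⟨t, s', h1, h2, h3, fun q q' h => h4 q q' q.isLt h⟩
  · rintro v hv s' ⟨hI, hsel', hC', hLF⟩ hi hsize
    have hnew : ∀ c < σ, Function.update (s'.arr .C) (code (T.L ⟨v, hv⟩))
        (s'.arr .C (code (T.L ⟨v, hv⟩)) + (T.cntL ⟨v, hv⟩).toNat) c =
        (Finset.univ.filter fun q => T.cntL q = true ∧ code (T.L q) < c).card +
        (Finset.univ.filter fun q : Fin T.size =>
          q.val < v + 1 ∧ T.cntL q = true ∧ code (T.L q) = c).card := by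
      intro c hc
      rw [card_filter_lt_succ _ hv, Function.update_apply]
      by_cases h : c = code (T.L ⟨v, hv⟩)
      · subst h
        rw [hC' _ hc]
        cases h : T.cntL ⟨v, hv⟩ <;> simp [add_assoc]
      · simp [h, Ne.symm h, hC' _ hc]
    refine ⟨_, _, Exec.seq (Exec.store _ _ _ _) (Exec.store _ _ _ _), by simp [Expr.cost],
      hi, hsize, ?_, ?_, ?_, ?_⟩
    · exact ((hI.setArr _ _ (by simp)).setArr _ _ (by simp)).setReg _ (by simp)
    · simp [State.setReg_arr, State.setArr_arr, hsel']
    · intro c hc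
      rw [← hnew c hc]
      simp [State.setReg_arr, State.setArr_arr, Expr.eval, hi, hI.L, hI.cntL, initState_L hv,
        initState_cntL hv]
    · intro q q' hqv hq
      by_cases h : q.val = v
      · subst h
        obtain ⟨h5, h6⟩ := generalizedLF_spec hq
        have h7 := hnew (code (T.L q)) (hσ q)
        simp only [hcode, hcode', Nat.lt_succ_iff, ← Fin.le_def] at h7
        rw [← h6] at h7
        rw [← hsel q' h5, ← hsel', ← h7]
        simp [State.setReg_arr, State.setArr_arr, State.setArr_reg, Expr.eval, hi, hI.L, hI.cntL,
          initState_L hv, initState_cntL hv]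
      · rw [← hLF q q' (by omega) hq]
        simp [State.setReg_arr, State.setArr_arr, State.setArr_reg, Expr.eval, hi, h]

/-- The register `k` remembers the latest one of `cntL`. The invariant is conditional, so nothing is
claimed while no one has been seen. -/
theorem exec_topTable {s : State} (hs : HasInput (initState T len code σ) s) :
    ∃ t s', Exec topTable s t s' ∧ t ≤ T.size * 16 + 7 ∧
      HasInput (initState T len code σ) s' ∧ s'.arr .LF = s.arr .LF ∧
      ∀ q q', uppermost T q = some q' → s'.arr .top q = q' := by
  have hfor := exec_forUpTo (r := .i) (bound := .size) (by simp)
    (P := .seq (.ite (.eq (.get .cntL (.reg .i)) (.lit 1)) (.assign .k (.reg .i)) .skip)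
     (.store .top (.reg .i) (.reg .k))) (c := 9) (N := T.size)
    (fun v s' => HasInput (initState T len code σ) s' ∧ s'.arr .LF = s.arr .LF ∧
      (∀ q : Fin T.size, q.val < v → T.cntL q = true →
        (∀ x, q < x → x.val < v → T.cntL x = false) → s'.reg .k = q) ∧
      ∀ q q', q.val < v → uppermost T q = some q' → s'.arr .top q = q') ?_
    (s.setReg .k 0) (by rw [State.setReg_reg]; exact hs.size)
    ⟨(hs.setReg _ (by simp)).setReg _ (by simp), rfl, by simp, by simp⟩
  · obtain ⟨t, s', h1, h2, h3, h4, -, h5⟩ := hfor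
    refine ⟨_, s', Exec.seq (Exec.assign .k (.lit 0) s) h1, ?_, h3, h4,
      fun q q' h => h5 q q' q.isLt h⟩
    simp only [Expr.cost]; omega
  · rintro v hv s' ⟨hI, hLF, hk, htop⟩ hi hsize
    have hstep : ∃ t s'', Exec (.ite (.eq (.get .cntL (.reg .i)) (.lit 1))
        (.assign .k (.reg .i)) .skip) s' t s'' ∧ t ≤ 6 ∧
        s''.arr = s'.arr ∧ (∀ r, r ≠ .k → s''.reg r = s'.reg r) ∧
        (∀ q : Fin T.size, q.val < v + 1 → T.cntL q = true →
        (∀ x, q < x → x.val < v + 1 → T.cntL x = false) → s''.reg .k = q) := by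
      cases hb : T.cntL ⟨v, hv⟩ with
      | true =>
        refine ⟨_, _, Exec.ite_true ?_ (Exec.assign _ _ _), by simp [Expr.cost, Test.cost], rfl,
          ?_, ?_⟩
        · simp [Test.eval, Expr.eval, hi, hI.cntL, initState_cntL hv, hb]
        · intro r hr
          simp [State.setReg_reg, hr]
        · intro q hq _ hx
          simp only [State.setReg_reg, Expr.eval, if_true, hi]
          by_contra hne
          have := hx ⟨v, hv⟩ (by rw [Fin.lt_def]; simp only; omega) (by simp)
          rw [hb] at this
          exact Bool.false_ne_true this.symm
      | false =>
        refine ⟨_, _, Exec.ite_false ?_ (Exec.skip _), by simp [Expr.cost, Test.cost], rfl,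
          fun _ _ => rfl, ?_⟩
        · simp [Test.eval, Expr.eval, hi, hI.cntL, initState_cntL hv, hb]
        · intro q hq hqb hx
          have hqv : q.val ≠ v := by
            rintro rfl
            rw [hqb] at hb
            exact Bool.false_ne_true hb.symm
          exact hk q (by omega) hqb fun x hqx hxv => hx x hqx (by omega)
    obtain ⟨t, s'', hex, ht, harr, hreg, hk'⟩ := hstep
    refine ⟨_, _, Exec.seq hex (Exec.store _ _ _ _), by simp only [Expr.cost]; omega,
      ?_, ?_, ?_, ?_, ?_, ?_⟩
    · simp [State.setArr_reg, hreg, hi]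
    · simp [State.setArr_reg, hreg, hsize]
    · refine HasInput.setReg (HasInput.setArr (hI.congr ?_ ?_) _ _ (by simp)) _ (by simp)
      · intro r hr
        apply hreg
        rintro rfl
        simp at hr
      · intro a _
        rw [harr]
    · simp [State.setReg_arr, State.setArr_arr, harr, hLF]
    · intro q h1 h2 h3
      simpa [State.setReg_reg, State.setArr_reg] using hk' q h1 h2 h3
    · intro q q' hqv hq
      simp only [State.setReg_arr, State.setArr_arr, Expr.eval, harr, if_true,
        Function.update_apply, hreg Reg.i (by simp), hi]
      split_ifs with h
      · obtain ⟨h4, h5, h6⟩ := uppermost_spec hq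
        rw [Fin.le_def] at h4
        exact hk' q' (by omega) h5 fun x hx hxv => h6 x hx (by rw [Fin.le_def]; omega)
      · exact htop q q' (by omega) hq

/-! ### The walk -/

/-- The stack, held in an array with its top at the highest index. -/
def HoldsStack (f : ℕ → ℕ) : List ℕ → Prop
  | [] => True
  | o :: l => f l.length = o ∧ HoldsStack f l

theorem HoldsStack.update {f : ℕ → ℕ} {l : List ℕ} (h : HoldsStack f l) {i : ℕ}
    (hi : l.length ≤ i) (v : ℕ) : HoldsStack (Function.update f i v) l := by
  induction l with
  | nil => trivial
  | cons o l ih =>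
    rw [List.length_cons] at hi
    exact ⟨by rw [Function.update_of_ne (by omega)]; exact h.1, ih h.2 (by omega)⟩

/-- The array `f` contains the list from the index `m` on. -/
def HoldsFrom (f : ℕ → ℕ) : ℕ → List ℕ → Prop
  | _, [] => True
  | m, a :: l => f m = a ∧ HoldsFrom f (m + 1) l

theorem HoldsFrom.update {f : ℕ → ℕ} {m : ℕ} {l : List ℕ} (h : HoldsFrom f m l) {i : ℕ}
    (hi : i < m) (v : ℕ) : HoldsFrom (Function.update f i v) m l := by
  induction l generalizing m with
  | nil => trivial
  | cons a l ih =>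
    exact ⟨by rw [Function.update_of_ne (by omega)]; exact h.1, ih h.2 (by omega)⟩

theorem HoldsFrom.getElem {f : ℕ → ℕ} {m : ℕ} {l : List ℕ} (h : HoldsFrom f m l) {i : ℕ}
    (hi : i < l.length) : f (m + i) = l[i] := by
  induction l generalizing m i with
  | nil => simp at hi
  | cons a l ih =>
    cases i with
    | zero => exact h.1
    | succ i =>
      rw [List.length_cons] at hi
      have := ih h.2 (i := i) (by omega)
      rw [List.getElem_cons_succ, ← this]
      congr 1
      omega

/-- The part of the walk that leaves a tunnel. -/
def leaveProg : Prog :=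
  .ite (.eq (.get .cntF (.add (.reg .j) (.lit 1))) (.lit 0))
      (.seq (.assign .j (.add (.reg .j) (.get .stack (.sub (.reg .sp) (.lit 1)))))
       (.assign .sp (.sub (.reg .sp) (.lit 1))))
      .skip

/-- The part of the walk that enters a tunnel. -/
def enterProg : Prog :=
  .ite (.or (.eq (.get .cntL (.reg .j)) (.lit 0))
          (.eq (.get .cntL (.add (.reg .j) (.lit 1))) (.lit 0)))
      (.seq (.assign .k (.get .top (.reg .j)))
       (.seq (.store .stack (.reg .sp) (.sub (.reg .j) (.reg .k)))
       (.assign .sp (.add (.reg .sp) (.lit 1)))))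
      .skip

/-- One iteration of the walk. -/
def walkStep : Prog :=
  .seq (.assign .i (.sub (.reg .i) (.lit 1)))
   (.seq leaveProg
   (.seq (.store .S (.reg .i) (.get .L (.reg .j)))
   (.seq enterProg
   (.assign .j (.get .LF (.reg .j))))))

/-- Success of `leaveTunnel` rules out an empty stack, so the truncated `sp - 1` is the true top
index. Popping lowers `sp` and leaves the array alone. -/
theorem exec_leaveProg {s : State} (hs : HasInput (initState T len code σ) s)
    {j j' : Fin T.size} {stack stack' : List ℕ} (hj : s.reg .j = j)
    (hsp : s.reg .sp = stack.length) (hst : HoldsStack (s.arr .stack) stack)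
    (h : leaveTunnel T j stack = some (j', stack')) :
    ∃ t s', Exec leaveProg s t s' ∧ t ≤ 20 ∧ s'.reg .j = j' ∧ s'.reg .sp = stack'.length ∧
      HoldsStack (s'.arr .stack) stack' ∧ s'.arr = s.arr ∧
      ∀ r, r ≠ .j → r ≠ .sp → s'.reg r = s.reg r := by
  unfold leaveTunnel at h
  split_ifs at h with hb
  · cases stack with
    | nil => simp at h
    | cons o l =>
      simp only at h
      split_ifs at h with hlt
      simp only [Option.some.injEq, Prod.mk.injEq] at h
      obtain ⟨rfl, rfl⟩ := h
      refine ⟨_, _, Exec.ite_true ?_ (Exec.seq (Exec.assign _ _ _) (Exec.assign _ _ _)),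
        by simp [Expr.cost, Test.cost], ?_, ?_, hst.2, rfl, ?_⟩
      · simp [Test.eval, Expr.eval, hj, hs.cntF, initState_cntF_succ j.isLt, hb]
      · have := hst.1
        simp [State.setReg_reg, Expr.eval, hj, hsp, this]
      · simp [State.setReg_reg, Expr.eval, hsp]
      · intro r h1 h2
        simp [State.setReg_reg, h1, h2]
  · simp only [Option.some.injEq, Prod.mk.injEq] at h
    obtain ⟨rfl, rfl⟩ := h
    refine ⟨_, s, Exec.ite_false ?_ (Exec.skip _), by simp [Expr.cost, Test.cost], hj, hsp, hst,
      rfl, fun _ _ _ => rfl⟩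
    simp [Test.eval, Expr.eval, hj, hs.cntF, initState_cntF_succ j.isLt, hb]

theorem exec_enterProg {s : State} (hs : HasInput (initState T len code σ) s)
    (htop : ∀ q q', uppermost T q = some q' → s.arr .top q = q')
    {j : Fin T.size} {stack stack' : List ℕ} (hj : s.reg .j = j)
    (hsp : s.reg .sp = stack.length) (hst : HoldsStack (s.arr .stack) stack)
    (h : enterTunnel T j stack = some stack') :
    ∃ t s', Exec enterProg s t s' ∧ t ≤ 30 ∧ s'.reg .sp = stack'.length ∧
      HoldsStack (s'.arr .stack) stack' ∧ (∀ a, a ≠ .stack → s'.arr a = s.arr a) ∧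
      ∀ r, r ≠ .k → r ≠ .sp → s'.reg r = s.reg r := by
  unfold enterTunnel at h
  split_ifs at h with hb
  · obtain ⟨l, hl, rfl⟩ := Option.map_eq_some_iff.1 h
    refine ⟨_, _, Exec.ite_true ?_ (Exec.seq (Exec.assign _ _ _)
      (Exec.seq (Exec.store _ _ _ _) (Exec.assign _ _ _))),
      by simp [Expr.cost, Test.cost], ?_, ?_, ?_, ?_⟩
    · simp only [Test.eval, Expr.eval, hj, hs.cntL, initState_cntL j.isLt,
        initState_cntL_succ j.isLt, Bool.or_eq_true, decide_eq_true_eq, Bool.toNat_eq_zero]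
      exact hb
    · simp [State.setReg_reg, State.setArr_reg, Expr.eval, hsp]
    · simp only [State.setReg_reg, State.setReg_arr, State.setArr_arr, State.setArr_reg, Expr.eval,
        hsp, hj, htop j l hl]
      refine ⟨by simp, ?_⟩
      simpa using hst.update le_rfl _
    · intro a ha
      simp [State.setReg_arr, State.setArr_arr, ha]
    · intro r h1 h2
      simp [State.setReg_reg, State.setArr_reg, h1, h2]
  · simp only [Option.some.injEq] at h
    subst h
    refine ⟨_, s, Exec.ite_false ?_ (Exec.skip _), by simp [Expr.cost, Test.cost], hsp, hst,
      fun _ _ => rfl, fun _ _ _ => rfl⟩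
    rw [← Bool.not_eq_true]
    simp only [Test.eval, Expr.eval, hj, hs.cntL, initState_cntL j.isLt,
      initState_cntL_succ j.isLt, Bool.or_eq_true, decide_eq_true_eq, Bool.toNat_eq_zero]
    exact hb

/-- The state `s` of the machine represents a state of the walk. -/
structure WalkState (T : TunneledBWT Γ) (len : ℕ) (code : Γ → ℕ) (σ : ℕ) (m : ℕ)
    (j : Fin T.size) (stack : List ℕ) (acc : List Γ) (s : State) : Prop where
  input : HasInput (initState T len code σ) s
  lf : ∀ q q', generalizedLF T q = some q' → s.arr .LF q = q'
  top : ∀ q q', uppermost T q = some q' → s.arr .top q = q'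
  reg_i : s.reg .i = m
  reg_j : s.reg .j = j
  reg_sp : s.reg .sp = stack.length
  stack : HoldsStack (s.arr .stack) stack
  text : HoldsFrom (s.arr .S) m (acc.map code)

theorem exec_walkStep {m : ℕ} {j j' j'' : Fin T.size} {stack stack' stack'' : List ℕ}
    {acc : List Γ} {s : State} (hs : WalkState T len code σ (m + 1) j stack acc s)
    (h1 : leaveTunnel T j stack = some (j', stack'))
    (h2 : enterTunnel T j' stack' = some stack'') (h3 : generalizedLF T j' = some j'') :
    ∃ t s', Exec walkStep s t s' ∧ t ≤ 70 ∧
      WalkState T len code σ m j'' stack'' (T.L j' :: acc) s' := by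
  have hi := hs.input.setReg (r := .i) m (by simp)
  obtain ⟨t₁, s₁, ex₁, ht₁, hj₁, hsp₁, hst₁, harr₁, hreg₁⟩ := exec_leaveProg hi
    (by simpa [State.setReg_reg] using hs.reg_j) (by simpa [State.setReg_reg] using hs.reg_sp)
    hs.stack h1
  have hI₁ : HasInput (initState T len code σ) s₁ := by
    refine hi.congr (fun r hr => hreg₁ r ?_ ?_) (fun a _ => by rw [harr₁])
    · rintro rfl; simp at hr
    · rintro rfl; simp at hr
  have hi₁ : s₁.reg .i = m := by
    rw [hreg₁ _ (by simp) (by simp), State.setReg_reg, if_pos rfl]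
  rw [State.setReg_arr] at harr₁
  obtain ⟨t₂, s₂, ex₂, ht₂, hsp₂, hst₂, harr₂, hreg₂⟩ := exec_enterProg
    (s := s₁.setArr .S m (code (T.L j'))) (hI₁.setArr _ _ (by simp))
    (by simpa [State.setArr_arr, harr₁] using hs.top) (by simpa [State.setArr_reg] using hj₁)
    (by simpa [State.setArr_reg] using hsp₁) (by simpa [State.setArr_arr] using hst₁) h2
  have ex0 : Exec (.assign .i (.sub (.reg .i) (.lit 1))) s 4 (s.setReg .i m) := by
    have := Exec.assign .i (.sub (.reg .i) (.lit 1)) s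
    simpa [Expr.cost, Expr.eval, hs.reg_i] using this
  have exS : Exec (.store .S (.reg .i) (.get .L (.reg .j))) s₁ 4
      (s₁.setArr .S m (code (T.L j'))) := by
    have := Exec.store .S (.reg .i) (.get .L (.reg .j)) s₁
    simpa [Expr.cost, Expr.eval, hi₁, hj₁, hI₁.L, initState_L j'.isLt] using this
  have hj₂ : s₂.reg .j = j' := by
    rw [hreg₂ _ (by simp) (by simp), State.setArr_reg, hj₁]
  have hlf₂ : s₂.arr .LF = s.arr .LF := by
    rw [harr₂ _ (by simp), State.setArr_arr, harr₁]; simp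
  have htop₂ : s₂.arr .top = s.arr .top := by
    rw [harr₂ _ (by simp), State.setArr_arr, harr₁]; simp
  have exj : Exec (.assign .j (.get .LF (.reg .j))) s₂ 3 (s₂.setReg .j j'') := by
    have := Exec.assign .j (.get .LF (.reg .j)) s₂
    simpa [Expr.cost, Expr.eval, hj₂, hlf₂, hs.lf _ _ h3] using this
  refine ⟨_, _, Exec.seq ex0 (Exec.seq ex₁ (Exec.seq exS (Exec.seq ex₂ exj))), by omega, ?_⟩
  refine ⟨HasInput.setReg (HasInput.congr (hI₁.setArr (a := .S) m (code (T.L j')) (by simp))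
    (fun r hr => hreg₂ r ?_ ?_) (fun a ha => harr₂ a ?_)) _ (by simp), ?_, ?_, ?_, ?_, ?_, ?_, ?_⟩
  · rintro rfl; simp at hr
  · rintro rfl; simp at hr
  · rintro rfl; simp at ha
  · simpa [State.setReg_arr, hlf₂] using hs.lf
  · simpa [State.setReg_arr, htop₂] using hs.top
  · rw [State.setReg_reg, if_neg (by simp), hreg₂ _ (by simp) (by simp), State.setArr_reg, hi₁]
  · rw [State.setReg_reg, if_pos rfl]
  · rw [State.setReg_reg, if_neg (by simp), hsp₂]
  · exact hst₂
  · rw [State.setReg_arr, harr₂ _ (by simp), State.setArr_arr, if_pos rfl, harr₁, List.map_cons]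
    exact ⟨by simp, hs.text.update (Nat.lt_succ_self m) _⟩

/-- A successful abstract run supplies the intermediate results of each iteration, so the machine
needs no checks of its own. An iteration costs at most 70, plus 3 for the test. -/
theorem exec_walkLoop (m : ℕ) : ∀ (j : Fin T.size) (stack : List ℕ) (acc out : List Γ) (s : State),
    WalkState T len code σ m j stack acc s → reconstructLoop T m j stack acc = some out →
    ∃ t s', Exec (.while (.lt (.lit 0) (.reg .i)) walkStep) s t s' ∧ t ≤ m * 73 + 3 ∧
      HoldsFrom (s'.arr .S) 0 (out.map code) := by
  induction m with
  | zero =>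
    intro j stack acc out s hs h
    simp only [reconstructLoop, Option.some.injEq] at h
    subst h
    refine ⟨_, s, Exec.while_false ?_, by simp [Expr.cost, Test.cost], hs.text⟩
    simp [Test.eval, Expr.eval, hs.reg_i]
  | succ m ih =>
    intro j stack acc out s hs h
    simp only [reconstructLoop, Option.bind_eq_some_iff, Prod.exists] at h
    obtain ⟨j', stack', h1, stack'', h2, j'', h3, h4⟩ := h
    obtain ⟨t, s', hex, ht, hs'⟩ := exec_walkStep hs h1 h2 h3
    obtain ⟨t', s'', hex', ht', hS⟩ := ih _ _ _ _ _ hs' h4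
    refine ⟨_, s'', Exec.while_true ?_ hex hex', ?_, hS⟩
    · simp [Test.eval, Expr.eval, hs.reg_i]
    · simp only [Expr.cost, Test.cost]; omega

theorem exec_walk {s : State} (hs : HasInput (initState T len code σ) s)
    (hlf : ∀ q q', generalizedLF T q = some q' → s.arr .LF q = q')
    (htop : ∀ q q', uppermost T q = some q' → s.arr .top q = q') (hlen : 0 < len)
    {out : List Γ} (hout : reconstruct T len = some out) :
    ∃ t s', Exec walk s t s' ∧ t ≤ len * 73 + 20 ∧ HoldsFrom (s'.arr .S) 0 (out.map code) := by
  rw [reconstruct] at hout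
  split_ifs at hout with hpos
  have hlen' : s.reg .textLen = len := hs.textLen
  have hd : s.reg .dollar = code ⊥ := hs.dollar
  have ex1 : Exec (.store .S (.sub (.reg .textLen) (.lit 1)) (.reg .dollar)) s 5
      (s.setArr .S (len - 1) (code ⊥)) := by
    have := Exec.store .S (.sub (.reg .textLen) (.lit 1)) (.reg .dollar) s
    simpa [Expr.cost, Expr.eval, hlen', hd] using this
  set s₁ := s.setArr .S (len - 1) (code ⊥) with hs₁
  have ex2 := Exec.assign .sp (.lit 0) s₁
  have ex3 := Exec.assign .j (.lit 0) (s₁.setReg .sp 0)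
  have ex4 : Exec (.assign .i (.sub (.reg .textLen) (.lit 1))) ((s₁.setReg .sp 0).setReg .j 0) 4
      (((s₁.setReg .sp 0).setReg .j 0).setReg .i (len - 1)) := by
    have := Exec.assign .i (.sub (.reg .textLen) (.lit 1)) ((s₁.setReg .sp 0).setReg .j 0)
    simpa [Expr.cost, Expr.eval, State.setReg_reg, hs₁, State.setArr_reg, hlen'] using this
  have hW : WalkState T len code σ (len - 1) ⟨0, hpos⟩ [] [⊥]
      (((s₁.setReg .sp 0).setReg .j 0).setReg .i (len - 1)) := by
    refine ⟨?_, ?_, ?_, ?_, ?_, ?_, trivial, ?_⟩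
    · exact (((hs.setArr _ _ (by simp)).setReg _ (by simp)).setReg _ (by simp)).setReg _ (by simp)
    · simpa [State.setReg_arr, hs₁, State.setArr_arr] using hlf
    · simpa [State.setReg_arr, hs₁, State.setArr_arr] using htop
    · simp [State.setReg_reg]
    · simp [State.setReg_reg]
    · simp [State.setReg_reg]
    · exact ⟨by simp [State.setReg_arr, hs₁, State.setArr_arr], trivial⟩
  obtain ⟨t, s', hex, ht, hS⟩ := exec_walkLoop _ _ _ _ _ _ hW hout
  -- `walkStep` unfolds to the loop body of `walk`, so the pieces fit definitionally.
  refine ⟨_, s', Exec.seq ex1 (Exec.seq ex2 (Exec.seq ex3 (Exec.seq ex4 hex))), ?_, hS⟩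
  simp only [Expr.cost]
  omega

/-- If the reconstruction algorithm succeeds, then the machine computes its result in linear
time. -/
theorem exec_reconstructProgram (hσ : ∀ q, code (T.L q) < σ)
    (hcode : ∀ q q', code (T.L q) < code (T.L q') ↔ T.L q < T.L q') (hlen : 0 < len)
    {out : List Γ} (hout : reconstruct T len = some out) :
    ∃ t s, Exec reconstructProgram (initState T len code σ) t s ∧
      t ≤ T.size * 75 + σ * 17 + len * 73 + 60 ∧ HoldsFrom (s.arr .S) 0 (out.map code) := by
  obtain ⟨t₁, s₁, ex₁, ht₁, hI₁, hC₁⟩ := exec_countChars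
    (HasInput.refl (initState T len code σ)) (fun c => rfl)
  obtain ⟨t₂, s₂, ex₂, ht₂, hI₂, hC₂⟩ := exec_prefixSums hI₁ hC₁
  obtain ⟨t₃, s₃, ex₃, ht₃, hI₃, hC₃, hsel₃⟩ := exec_selectTable hI₂
  rw [← hC₃] at hC₂
  obtain ⟨t₄, s₄, ex₄, ht₄, hI₄, hlf₄⟩ := exec_lfTable hI₃ hσ hcode hC₂ hsel₃
  obtain ⟨t₅, s₅, ex₅, ht₅, hI₅, hlf₅, htop₅⟩ := exec_topTable hI₄
  rw [← hlf₅] at hlf₄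
  obtain ⟨t₆, s₆, ex₆, ht₆, hS₆⟩ := exec_walk hI₅ hlf₄ htop₅ hlen hout
  exact ⟨_, s₆, Exec.seq ex₁ (Exec.seq ex₂ (Exec.seq ex₃ (Exec.seq ex₄ (Exec.seq ex₅ ex₆)))),
    by omega, hS₆⟩

end

theorem tunnel_size_le {Γ : Type u} [LinearOrder Γ] {n : ℕ} (L : Fin n → Γ)
    (𝓑 : Set (Block n)) : (tunnel L 𝓑).size ≤ n :=
  (Finset.card_le_univ (remaining L 𝓑)).trans_eq (Fintype.card_fin n)

end Tunneling

theorem theorem1 :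
    ∀ K : ℕ, ∃ c : ℕ, ∀ (Γ : Type*) [LinearOrder Γ] [OrderBot Γ] (n : ℕ) (S : Fin n → Γ)
      (𝓑 : Set (Tunneling.Block n)),
      Tunneling.NullTerminated S →
      (∀ B ∈ 𝓑, Tunneling.IsBlock (Tunneling.bwt S) B) →
      Tunneling.NoCriticalCollisions (Tunneling.bwt S) 𝓑 →
      -- the algorithm recovers the string
      Tunneling.reconstruct (Tunneling.tunnel (Tunneling.bwt S) 𝓑) n = some (List.ofFn S) ∧
      -- and it does so in linear time, for an integer alphabet of size at most `K * n`
      ∀ (σ : ℕ) (code : Γ → ℕ), StrictMonoOn code (Set.range S) →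
        (∀ a ∈ Set.range S, code a < σ) → σ ≤ K * n →
        ∃ (t : ℕ) (s : Tunneling.State),
          Tunneling.Exec Tunneling.reconstructProgram
            (Tunneling.initState (Tunneling.tunnel (Tunneling.bwt S) 𝓑) n code σ) t s ∧
          t ≤ c * n ∧
          ∀ p : Fin n, s.arr Tunneling.Arr.S p = code (S p) := by
  intro K
  -- The bound `75 * size + 17 * σ + 73 * n + 60`, with `size ≤ n`, `σ ≤ K * n` and `1 ≤ n`; 208 is
  -- 75 + 73 + 60.
  refine ⟨17 * K + 208, fun Γ _ _ n S 𝓑 hS h𝓑 hC => ?_⟩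
  have hrec := Tunneling.reconstruct_tunnel hS h𝓑 hC
  refine ⟨hrec, fun σ code hcode hσ hK => ?_⟩
  -- The code is monotone and bounded only on the characters of `S`, so the tunneled string must not
  -- contain others.
  have hmem : ∀ q, (Tunneling.tunnel (Tunneling.bwt S) 𝓑).L q ∈ Set.range S :=
    fun q => Tunneling.bwt_mem_range hS _
  obtain ⟨t, s, hex, ht, hs⟩ := Tunneling.exec_reconstructProgram (fun q => hσ _ (hmem q))
    (fun q q' => hcode.lt_iff_lt (hmem q) (hmem q')) hS.pos hrec
  refine ⟨t, s, hex, ht.trans ?_, fun p => ?_⟩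
  · have h1 := Tunneling.tunnel_size_le (Tunneling.bwt S) 𝓑
    have h2 := hS.pos
    have h3 : (17 * K + 208) * n = 17 * (K * n) + 208 * n := by ring
    rw [h3]
    omega
  · have := hs.getElem (i := p) (by simp)
    simpa using this
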